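/- Graphs are finite and loopless, but may have multiple edges. For a graph $G$ and $S\subseteq V(G)$, let $\omega(G\setminus S)$ be the number of connected components of $G\setminus S$ (zero if $S=V(G)$) and let $I(G\setminus S)$ be the set of isolated vertices of $G\setminus S$. For a real function $t$ on $V(G)$, $G$ is called $t$-iso-tough if $\sum_{v\in I(G\setminus S)}t(v)\le |S|$ for all $S\subseteq V(G)$. A near $f$-factor of $G$ is a spanning subgraph $F$ such that $d_F(v)=f(v)$ for each vertex $v$, except for at most one vertex $u$, for which $d_F(u)=f(u)+1$. A star component is a component isomorphic to $K_{1,m}$ with $m\ge 0$ (so isolated vertices are star components, a star has no parallel edges, and in $K_{1,1}$ either vertex may be taken as the center). Theorem. Let $G$ be a graph, let $f$ be a positive integer-valued function on $V(G)$, and let $a>1$ be a real number with $f(v)\ge a$ for all $v\in V(G)$. (1) Let $h$ be a nonnegative real function on $V(G)$, and put $$t_0(a,f,h)(v)=\frac{1}{4(a-1)}\Big((f(v)+a-1)^2-4h(v)-\varepsilon_0(v)\Big),$$ where $\varepsilon_0(v)=1$ if $a$ is an integer of the same parity as $f(v)$, and $\varepsilon_0(v)=0$ otherwise. If $G$ is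 $t_0(a,f,h)$-iso-tough and for every $S\subseteq V(G)$ and every set $I_*$ consisting of exactly one center of each star component of $G\setminus S$ we have $$\sum_{v\in I_*}\big(f(v)+h(v)-1\big)+\omega(G\setminus S)\le |S|+1,$$ then $G$ admits a near $f$-factor. (2) Consequently, let $n>1$ be a real number and let $$t(v)=\max\Big\{\frac{n}{n-1}f(v),\ \frac{1}{4(a-\frac1n)}\big((f(v)+a-1)^2+4f(v)\big)\Big\}.$$ If $G$ is $t$-iso-tough and $\omega(G\setminus S)\le \frac1n|S|+1$ for all $S\subseteq V(G)$, then $G$ admits a near $f$-factor. -/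

import Mathlib

open scoped Graph

noncomputable section

namespace IsoTough

universe u v

variable {α : Type u} {β : Type v}

/-- The degree of a vertex in a loopless multigraph: the number of edges incident with it,
parallel edges being counted with multiplicity. -/
def degree (G : Graph α β) (x : α) : ℕ := (G.incidenceSet x).ncard

/-- The set of isolated vertices of `G`. -/
def isolatedVertices (G : Graph α β) : Set α := {x | x ∈ V(G) ∧ G.incidenceSet x = ∅}

/-- The vertex set of the connected component of `G` that contains `x` (for `x ∈ V(G)`). -/
def componentOf (G : Graph α β) (x : α) : Set α := {y | Relation.ReflTransGen G.Adj x y}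

/-- The vertex sets of the connected components of `G`. -/
def components (G : Graph α β) : Set (Set α) := componentOf G '' V(G)

/-- The number `ω(G)` of connected components of `G` (zero if `G` has no vertex). -/
def numComponents (G : Graph α β) : ℕ := (components G).ncard

/-- The component of `G` containing `c` is a star `K_{1,m}` with `m ≥ 0`, and `c` is a center of
it: every other vertex of the component is joined to `c` by exactly one edge, and every edge of
the component has `c` as an end. In `K_{1,0}` the only vertex is a center, and in `K_{1,1}` both
vertices are centers. -/
structure IsStarCenter (G : Graph α β) (c : α) : Prop where
  mem : c ∈ V(G)
  existsUnique_isLink : ∀ x ∈ componentOf G c, x ≠ c → ∃! e, G.IsLink e c x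
  eq_or_eq : ∀ e x y, x ∈ componentOf G c → G.IsLink e x y → x = c ∨ y = c

/-- `I` consists of exactly one center of each star component of `G`, and of nothing else. -/
structure IsStarCenterSet (G : Graph α β) (I : Set α) : Prop where
  isStarCenter : ∀ x ∈ I, IsStarCenter G x
  existsUnique : ∀ c, IsStarCenter G c → ∃! x, x ∈ I ∧ x ∈ componentOf G c

/-- `G` is `t`-iso-tough, for a real function `t` on the vertices: for every set `S` of vertices,
the sum of `t` over the isolated vertices of `G ∖ S` is at most `|S|`. -/
def IsIsoTough (G : Graph α β) (t : α → ℝ) : Prop :=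
  ∀ S ⊆ V(G), ∑ᶠ x ∈ isolatedVertices (G.deleteVerts S), t x ≤ (S.ncard : ℝ)

/-- `F` is a near `f`-factor of `G`: a spanning subgraph in which every vertex `x` has degree
`f x`, except for at most one vertex, which has degree one more than prescribed. -/
structure IsNearFactor (G : Graph α β) (f : α → ℕ) (F : Graph α β) : Prop where
  spanning : F ≤s G
  degree_eq : ∀ x ∈ V(G), degree F x = f x ∨ degree F x = f x + 1
  subsingleton : {x | x ∈ V(G) ∧ degree F x = f x + 1}.Subsingleton

/-- `G` admits a near `f`-factor. -/
def HasNearFactor (G : Graph α β) (f : α → ℕ) : Prop := ∃ F : Graph α β, IsNearFactor G f F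

open Classical in
/-- `1` if the real number `a` is an integer of the same parity as `k`, and `0` otherwise. -/
def parityIndicator (a : ℝ) (k : ℕ) : ℝ := if ∃ m : ℤ, a - (k : ℝ) = 2 * (m : ℝ) then 1 else 0

/-- The function `t₀(a, f, h)`. -/
def tZero (a : ℝ) (f : α → ℕ) (h : α → ℝ) (x : α) : ℝ :=
  1 / (4 * (a - 1)) * (((f x : ℝ) + a - 1) ^ 2 - 4 * h x - parityIndicator a (f x))

end IsoTough

end

/-! Near `f`-factors are perfect matchings in disguise. In the gadget graph every edge becomes two
adjacent half-edges, each vertex `v` gets `deg v - f v` slack vertices joined to its half-edges, and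
at most one apex, present only to make the order even, is joined to all slack vertices. The edges
whose halves are matched together have degree `f v` at `v`, plus one if the apex is matched to a
slack vertex of `v`. A Tutte barrier of least size then translates into a Lovász-type criterion,
`hasNearFactor_of_forall_disjoint`: if `f ≤ deg` and `f(T) + ω(G∖(S∪T)) ≤ f(S) + d(T) + 1` for all
disjoint `S` and `T`, where `d` is the degree in `G∖S`, then a near `f`-factor exists.

To verify the criterion, `exists_deletion_sets` picks independent sets in `T`: `I₁` greedily by the
deficit `f - d` among the vertices with `d < f`, then a maximal `I₀` among the vertices with `d = f`
not adjacent to `I₁`. Deleting `S` and the neighbours of `I₁` (the set `S₁`) isolates `I₁`; a larger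
set `S₂` turns `I₁ ∪ I₀` into centers of different star components. Iso-toughness at `S₁`,
multiplied by `a - 1`, is added to the star condition at `S₂`, and `h` cancels on the vertices
isolated by `S₁`. What remains at each vertex of `I₁` is the inequality `a d + (f - d)(1 + d) ≤ ((f
+ a - 1)² - ε₀)/4 + f` of `mul_add_le_quadTerm`, which explains the shape of `t₀`.

Part (2) is part (1) with `h = (1 - 1/n) t - f`. The star condition comes from two deletions: the
leaves of the nontrivial stars, which isolates the centers, and those centers, which isolates the
leaves. -/

namespace IsoTough

/-! ### Tutte's theorem: barriers of least size. -/

section TutteBarrier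

variable {W : Type*} (H : SimpleGraph W) (X : Set W)

/-- `y` can be reached from `x` in `H` without meeting `X`. -/
def ReachAvoid : W → W → Prop := Relation.ReflTransGen fun a b => H.Adj a b ∧ a ∉ X ∧ b ∉ X

/-- The vertex set of the component of `x` in `H ∖ X`. -/
def compAvoid (x : W) : Set W := {y | ReachAvoid H X x y}

/-- The vertex sets of the components of odd order of `H ∖ X`. -/
def oddCompsAvoid : Set (Set W) := {C | ∃ x, x ∉ X ∧ C = compAvoid H X x ∧ Odd C.ncard}

variable {H X}

theorem ReachAvoid.symm {x y : W} (h : ReachAvoid H X x y) : ReachAvoid H X y x := by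
  induction h with
  | refl => exact Relation.ReflTransGen.refl
  | tail _ h ih => exact Relation.ReflTransGen.head ⟨h.1.symm, h.2.2, h.2.1⟩ ih

theorem ReachAvoid.trans {x y z : W} (h : ReachAvoid H X x y) (h' : ReachAvoid H X y z) :
    ReachAvoid H X x z := Relation.ReflTransGen.trans h h'

theorem ReachAvoid.of_adj {x y : W} (h : H.Adj x y) (hx : x ∉ X) (hy : y ∉ X) :
    ReachAvoid H X x y := Relation.ReflTransGen.single ⟨h, hx, hy⟩

theorem ReachAvoid.notMem {x y : W} (h : ReachAvoid H X x y) (hx : x ∉ X) : y ∉ X := by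
  induction h with
  | refl => exact hx
  | tail _ h _ => exact h.2.2

theorem compAvoid_eq {x y : W} (h : ReachAvoid H X x y) : compAvoid H X x = compAvoid H X y :=
  Set.ext fun _ => ⟨fun hz => h.symm.trans hz, fun hz => h.trans hz⟩

theorem mem_compAvoid_self (x : W) : x ∈ compAvoid H X x := Relation.ReflTransGen.refl

/-- A set closed under adjacency contains the component of each of its elements. -/
theorem compAvoid_subset {x : W} {Q : Set W} (hx : x ∈ Q)
    (hQ : ∀ y ∈ Q, ∀ z, H.Adj y z → y ∉ X → z ∉ X → z ∈ Q) : compAvoid H X x ⊆ Q := by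
  intro y hy
  induction hy with
  | refl => exact hx
  | tail _ h ih => exact hQ _ ih _ h.1 h.2.1 h.2.2

theorem reachable_coe_iff (x y : ((⊤ : H.Subgraph).deleteVerts X).verts) :
    ((⊤ : H.Subgraph).deleteVerts X).coe.Reachable x y ↔ ReachAvoid H X x y := by
  constructor
  · rintro ⟨p⟩
    induction p with
    | nil => exact Relation.ReflTransGen.refl
    | cons h _ ih =>
      refine Relation.ReflTransGen.head ?_ ih
      rw [SimpleGraph.Subgraph.coe_adj, SimpleGraph.Subgraph.deleteVerts_adj] at h
      exact ⟨h.2.2.2.2, h.2.1, h.2.2.2.1⟩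
  · obtain ⟨y, hy⟩ := y
    intro h
    change ReachAvoid H X x y at h
    induction h with
    | refl => exact SimpleGraph.Reachable.refl _
    | @tail b c _ h ih =>
      refine (ih ⟨trivial, h.2.1⟩).trans (SimpleGraph.Adj.reachable ?_)
      rw [SimpleGraph.Subgraph.coe_adj, SimpleGraph.Subgraph.deleteVerts_adj]
      exact ⟨trivial, h.2.1, trivial, h.2.2, h.1⟩

theorem image_val_supp (x : ((⊤ : H.Subgraph).deleteVerts X).verts) :
    Subtype.val '' (((⊤ : H.Subgraph).deleteVerts X).coe.connectedComponentMk x).supp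
      = compAvoid H X x := by
  ext y
  constructor
  · rintro ⟨y, hy, rfl⟩
    rw [SimpleGraph.ConnectedComponent.mem_supp_iff, SimpleGraph.ConnectedComponent.eq,
      reachable_coe_iff] at hy
    exact hy.symm
  · intro hy
    refine ⟨⟨y, trivial, ReachAvoid.notMem hy x.2.2⟩, ?_, rfl⟩
    rw [SimpleGraph.ConnectedComponent.mem_supp_iff, SimpleGraph.ConnectedComponent.eq,
      reachable_coe_iff]
    exact ReachAvoid.symm hy

/-- Carries Tutte's condition from the subgraph left by deleting `X` to sets of vertices of `H`
itself, so that components for different `X` can be compared. -/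
theorem ncard_oddCompsAvoid :
    (oddCompsAvoid H X).ncard = ((⊤ : H.Subgraph).deleteVerts X).coe.oddComponents.ncard := by
  have hinj : Function.Injective
      (fun c : ((⊤ : H.Subgraph).deleteVerts X).coe.ConnectedComponent =>
        (Subtype.val '' c.supp : Set W)) := fun c d h =>
    SimpleGraph.ConnectedComponent.supp_injective (Subtype.val_injective.image_injective h)
  rw [← Set.ncard_image_of_injective _ hinj]
  congr 1
  ext C
  constructor
  · rintro ⟨x, hx, rfl, hodd⟩
    refine ⟨_, ?_, image_val_supp ⟨x, trivial, hx⟩⟩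
    rw [← image_val_supp ⟨x, trivial, hx⟩, Set.ncard_image_of_injective _ Subtype.val_injective]
      at hodd
    exact hodd
  · rintro ⟨c, hc, rfl⟩
    induction c using SimpleGraph.ConnectedComponent.ind with | _ x =>
    refine ⟨x, x.2.2, image_val_supp x, ?_⟩
    change Odd _ at hc
    rwa [Set.ncard_image_of_injective _ Subtype.val_injective]

variable (H) in
/-- A graph of even order without a perfect matching has a barrier `X` of deficiency at least two
each of whose vertices is adjacent to at least three components of `H ∖ X`. -/
theorem exists_barrier [Finite W] (heven : Even (Nat.card W))
    (hH : ¬ ∃ M : H.Subgraph, M.IsPerfectMatching) :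
    ∃ X : Set W, X.ncard + 2 ≤ (oddCompsAvoid H X).ncard ∧
      ∀ x ∈ X, ∀ a b, ∃ y, y ∉ X ∧ H.Adj x y ∧ ¬ ReachAvoid H X a y ∧ ¬ ReachAvoid H X b y := by
  classical
  rw [SimpleGraph.tutte] at hH
  push Not at hH
  -- The barrier is a violating set of least size; minimality will force the three components.
  have hex : ∃ n, ∃ X : Set W, X.ncard = n ∧ X.ncard < (oddCompsAvoid H X).ncard := by
    obtain ⟨X, hX⟩ := hH
    exact ⟨_, X, rfl, by rw [ncard_oddCompsAvoid]; exact hX⟩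
  obtain ⟨X, hXn, hX⟩ := Nat.find_spec hex
  have hmin : ∀ Y : Set W, Y.ncard < X.ncard → (oddCompsAvoid H Y).ncard ≤ Y.ncard := by
    intro Y hY
    by_contra! h
    exact Nat.find_min hex (hXn ▸ hY) ⟨Y, rfl, h⟩
  -- The number of odd components has the parity of `|W| - |X|`, hence of `|X|`; a positive excess
  -- is therefore at least two.
  have hpar : X.ncard + 2 ≤ (oddCompsAvoid H X).ncard := by
    have h1 := SimpleGraph.odd_ncard_oddComponents (G := ((⊤ : H.Subgraph).deleteVerts X).coe)
    rw [← ncard_oddCompsAvoid] at h1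
    have h2 : Nat.card ((⊤ : H.Subgraph).deleteVerts X).verts + X.ncard = Nat.card W := by
      rw [Nat.card_coe_set_eq, SimpleGraph.Subgraph.deleteVerts_verts,
        SimpleGraph.Subgraph.verts_top, Set.ncard_sdiff_add_ncard_of_subset (Set.subset_univ X),
        Set.ncard_univ]
    by_contra hlt
    have h3 : (oddCompsAvoid H X).ncard = X.ncard + 1 := by omega
    rw [h3] at h1
    rw [← h2] at heven
    grind
  refine ⟨X, hpar, fun x hx a b => ?_⟩
  by_contra! hcov
  -- If `x` met only the components of `a` and `b`, all others would survive putting `x` back. At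
  -- most two odd components are lost while the deficiency is at least two, so `X \ {x}` would be a
  -- smaller violating set.
  have hsub : oddCompsAvoid H X \ {compAvoid H X a, compAvoid H X b}
      ⊆ oddCompsAvoid H (X \ {x}) := by
    rintro _ ⟨⟨r, hr, rfl, hodd⟩, hne⟩
    simp only [Set.mem_insert_iff, Set.mem_singleton_iff, not_or] at hne
    have hcomp : compAvoid H X r = compAvoid H (X \ {x}) r := by
      apply Set.Subset.antisymm
      · apply compAvoid_subset (mem_compAvoid_self r)
        intro y hy z hyz hyX hzX
        exact ReachAvoid.trans hy (ReachAvoid.of_adj hyz (fun h => hyX h.1) fun h => hzX h.1)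
      · apply compAvoid_subset (mem_compAvoid_self r)
        intro y hy z hyz _ hzX
        have hyX : y ∉ X := ReachAvoid.notMem hy hr
        by_cases hzx : z = x
        · subst hzx
          by_cases hay : ReachAvoid H X a y
          · exact absurd (compAvoid_eq (ReachAvoid.trans hy hay.symm)) hne.1
          · exact absurd (compAvoid_eq (ReachAvoid.trans hy (hcov y hyX hyz.symm hay).symm)) hne.2
        · exact ReachAvoid.trans hy (ReachAvoid.of_adj hyz hyX fun h => hzX ⟨h, hzx⟩)
    exact ⟨r, fun h => hr h.1, hcomp, hodd⟩
  have h1 := Set.ncard_le_ncard hsub (Set.toFinite _)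
  have h2 := Set.le_ncard_sdiff {compAvoid H X a, compAvoid H X b} (oddCompsAvoid H X)
    (Set.toFinite _)
  have h3 : ({compAvoid H X a, compAvoid H X b} : Set (Set W)).ncard ≤ 2 := by
    have := Set.ncard_insert_le (compAvoid H X a) {compAvoid H X b}
    rwa [Set.ncard_singleton] at this
  have h4 : (X \ {x}).ncard + 1 = X.ncard := Set.ncard_sdiff_singleton_add_one hx (Set.toFinite _)
  have := hmin (X \ {x}) (by omega)
  omega

end TutteBarrier

/-! ### The gadget graph and its perfect matchings. -/

section Gadget

variable {α : Type*} {β : Type*}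

/-- The pairs of an edge of `G` and one of its ends. -/
abbrev HalfEdge (G : Graph α β) := {p : β × α // G.Inc p.1 p.2}

/-- For each vertex `v` of `G`, as many copies of `v` as its degree exceeds `f v`. -/
abbrev SlackVertex (G : Graph α β) (f : α → ℕ) :=
  {p : α × ℕ // p.1 ∈ V(G) ∧ p.2 < degree G p.1 - f p.1}

/-- The vertices of the gadget graph: half-edges, slack vertices and `k` apices. -/
abbrev GadgetVertex (G : Graph α β) (f : α → ℕ) (k : ℕ) :=
  HalfEdge G ⊕ SlackVertex G f ⊕ Fin k

variable {G : Graph α β} {f : α → ℕ} {k : ℕ}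

/-- The adjacency relation of the gadget graph. -/
def GadgetAdj : GadgetVertex G f k → GadgetVertex G f k → Prop
  | .inl p, .inl q => p.1.1 = q.1.1 ∧ p.1.2 ≠ q.1.2
  | .inl p, .inr (.inl b) => p.1.2 = b.1.1
  | .inr (.inl b), .inl p => p.1.2 = b.1.1
  | .inr (.inl _), .inr (.inr _) => True
  | .inr (.inr _), .inr (.inl _) => True
  | _, _ => False

variable (G f k) in
/-- The gadget graph: the two halves of an edge are adjacent, every half-edge at `v` is adjacent to
every slack vertex at `v`, and every slack vertex is adjacent to every apex. -/
def gadget : SimpleGraph (GadgetVertex G f k) where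
  Adj := GadgetAdj
  symm := ⟨by
    rintro (p | b | w) (q | c | z) h
    · exact ⟨h.1.symm, h.2.symm⟩
    all_goals exact h⟩
  loopless := ⟨by
    rintro (p | b | w) h
    · exact h.2 rfl
    all_goals exact h⟩

theorem finite_halfEdge (hV : V(G).Finite) (hE : E(G).Finite) : Finite (HalfEdge G) :=
  ((hE.prod hV).subset fun _ hp => ⟨hp.edge_mem, hp.vertex_mem⟩ :
    {p : β × α | G.Inc p.1 p.2}.Finite)

theorem finite_slackVertex (hV : V(G).Finite) : Finite (SlackVertex G f) := by
  have : {p : α × ℕ | p.1 ∈ V(G) ∧ p.2 < degree G p.1 - f p.1}.Finite := by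
    refine (hV.biUnion fun v _ => (Set.finite_Iio (degree G v - f v)).image (Prod.mk v)).subset ?_
    rintro ⟨v, i⟩ ⟨hv, hi⟩
    exact Set.mem_biUnion hv ⟨i, hi, rfl⟩
  exact this

theorem finite_incidenceSet (hE : E(G).Finite) (x : α) : (G.incidenceSet x).Finite :=
  hE.subset (G.incidenceSet_subset_edgeSet x)

/-- A perfect matching of the gadget graph with at most one apex yields a near factor. -/
theorem hasNearFactor_of_isPerfectMatching (hE : E(G).Finite)
    (hf : ∀ v ∈ V(G), f v ≤ degree G v) (hk : k ≤ 1) {M : (gadget G f k).Subgraph}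
    (hM : M.IsPerfectMatching) : HasNearFactor G f := by
  classical
  rw [SimpleGraph.Subgraph.isPerfectMatching_iff] at hM
  choose φ hφ hφu using hM
  have hinv : Function.Involutive φ := fun x => (hφu _ _ (hφ x).symm).symm
  have hadj : ∀ x, GadgetAdj x (φ x) := fun x => (hφ x).adj_sub
  -- `E₀` is the edge set of the factor. `N v` records the slack vertices of `v` matched to an apex,
  -- which are responsible for excess degree.
  let E₀ : Set β := {e | ∃ p q : HalfEdge G, p.1.1 = e ∧ φ (.inl p) = .inl q}
  let N : α → Set ℕ := fun v =>
    {i | ∃ h : v ∈ V(G) ∧ i < degree G v - f v, ∃ w, φ (.inr (.inl ⟨(v, i), h⟩)) = .inr (.inr w)}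
  -- As `k ≤ 1`, at most one slack vertex in the whole gadget is matched to an apex.
  have hNuniq : ∀ u i v j, i ∈ N u → j ∈ N v → u = v ∧ i = j := by
    rintro u i v j ⟨h, w, hw⟩ ⟨h', w', hw'⟩
    have hww : w = w' := by
      apply Fin.ext; omega
    rw [← hww, ← hw] at hw'
    have := hinv.injective hw'
    simp only [Sum.inr.injEq, Sum.inl.injEq, Subtype.mk.injEq, Prod.mk.injEq] at this
    exact ⟨this.1.symm, this.2.symm⟩
  have hE₀ : ∀ e v (h : G.Inc e v), e ∈ E₀ ↔ ∃ q, φ (.inl ⟨(e, v), h⟩) = .inl q := by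
    intro e v h
    constructor
    · rintro ⟨p, q, rfl, hpq⟩
      have had := hadj (.inl p)
      rw [hpq] at had
      obtain ⟨h1, h2⟩ := had
      have hq : G.Inc p.1.1 q.1.2 := h1 ▸ q.2
      rcases h.eq_or_eq_or_eq p.2 hq with h3 | h3 | h3
      · refine ⟨q, ?_⟩
        rw [← hpq]; congr 2; exact Subtype.ext (Prod.ext rfl h3)
      · refine ⟨p, ?_⟩
        rw [← hinv (.inl p), hpq]; congr 2; exact Subtype.ext (Prod.ext h1 h3)
      · exact absurd h3 h2
    · rintro ⟨q, hq⟩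
      exact ⟨_, q, rfl, hq⟩
  -- The matching is a bijection between the half-edges at `v` of edges outside `E₀` and the slack
  -- vertices at `v` not matched to an apex.
  have hcount : ∀ v ∈ V(G), (G.incidenceSet v \ E₀).ncard + (N v).ncard = degree G v - f v := by
    intro v hv
    let A : Set (GadgetVertex G f k) :=
      {x | ∃ e, ∃ h : G.Inc e v, e ∉ E₀ ∧ x = .inl ⟨(e, v), h⟩}
    let B : Set (GadgetVertex G f k) :=
      {x | ∃ i, ∃ h : v ∈ V(G) ∧ i < degree G v - f v, i ∉ N v ∧ x = .inr (.inl ⟨(v, i), h⟩)}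
    have hA : A.ncard = (G.incidenceSet v \ E₀).ncard := by
      symm
      refine Set.ncard_congr (fun e he => .inl ⟨(e, v), he.1⟩) ?_ ?_ ?_
      · exact fun e he => ⟨e, he.1, he.2, rfl⟩
      · intro e e' he he' h
        exact congrArg (fun x : HalfEdge G => x.1.1) (Sum.inl.inj h)
      · rintro _ ⟨e, h, he, rfl⟩
        exact ⟨e, ⟨h, he⟩, rfl⟩
    have hB : B.ncard = (Set.Iio (degree G v - f v) \ N v).ncard := by
      symm
      refine Set.ncard_congr (fun i hi => .inr (.inl ⟨(v, i), hv, hi.1⟩)) ?_ ?_ ?_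
      · exact fun i hi => ⟨i, ⟨hv, hi.1⟩, hi.2, rfl⟩
      · intro i j hi hj h
        simpa using h
      · rintro _ ⟨i, h, hi, rfl⟩
        exact ⟨i, ⟨h.2, hi⟩, rfl⟩
    have hAB : φ '' A = B := by
      ext y
      constructor
      · rintro ⟨_, ⟨e, h, he, rfl⟩, rfl⟩
        rw [hE₀ e v h] at he
        have had := hadj (.inl ⟨(e, v), h⟩)
        rcases hy : φ (.inl ⟨(e, v), h⟩) with q | ⟨⟨u, i⟩, hb⟩ | w
        · exact absurd ⟨q, hy⟩ he
        · rw [hy] at had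
          obtain rfl : v = u := had
          refine ⟨i, hb, ?_, rfl⟩
          rintro ⟨h', w, hw⟩
          rw [← hy, hinv] at hw
          simp at hw
        · rw [hy] at had
          exact had.elim
      · rintro ⟨i, h, hi, rfl⟩
        refine ⟨φ (.inr (.inl ⟨(v, i), h⟩)), ?_, hinv _⟩
        have had := hadj (.inr (.inl ⟨(v, i), h⟩))
        rcases hy : φ (.inr (.inl ⟨(v, i), h⟩)) with ⟨⟨e, u⟩, hp⟩ | b | w
        · rw [hy] at had
          obtain rfl : u = v := had
          refine ⟨e, hp, ?_, rfl⟩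
          rw [hE₀ e u hp]
          rintro ⟨q, hq⟩
          rw [← hy, hinv] at hq
          simp at hq
        · rw [hy] at had
          exact had.elim
        · exact absurd ⟨h, w, hy⟩ hi
    have hNsub : N v ⊆ Set.Iio (degree G v - f v) := fun i hi => hi.choose.2
    rw [← hA, ← Set.ncard_image_of_injective A hinv.injective, hAB, hB,
      Set.ncard_sdiff_add_ncard_of_subset hNsub (Set.finite_Iio _)]
    simp
  have hdeg : ∀ v ∈ V(G), degree (G.restrict E₀) v = f v + (N v).ncard := by
    intro v hv
    have h1 : degree (G.restrict E₀) v = (G.incidenceSet v ∩ E₀).ncard := by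
      unfold degree
      congr 1
      ext e
      simp
    have h2 := Set.ncard_inter_add_ncard_sdiff_eq_ncard (G.incidenceSet v) E₀
      (finite_incidenceSet hE v)
    have h3 := hcount v hv
    have h4 := hf v hv
    change _ = degree G v at h2
    omega
  have hN1 : ∀ v, (N v).ncard ≤ 1 := fun v => by
    have hs : (N v).Subsingleton := fun i hi j hj => (hNuniq v i v j hi hj).2
    have : Finite (N v) := hs.finite
    exact Set.ncard_le_one_iff_subsingleton.mpr hs
  refine ⟨G.restrict E₀, ⟨Graph.restrict_le, rfl⟩, ?_, ?_⟩
  · intro x hx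
    have h1 := hdeg x hx
    change x ∈ V(G) at hx
    have := hN1 x
    omega
  · rintro x ⟨hx, hxd⟩ y ⟨hy, hyd⟩
    rw [hdeg x hx] at hxd
    rw [hdeg y hy] at hyd
    obtain ⟨i, hi⟩ := Set.nonempty_of_ncard_ne_zero (s := N x) (by omega)
    obtain ⟨j, hj⟩ := Set.nonempty_of_ncard_ne_zero (s := N y) (by omega)
    exact (hNuniq x i y j hi hj).1

end Gadget

/-! ### From barriers of the gadget to a degree criterion. -/

section NearFactorCriterion

variable {α : Type*} {β : Type*} {G : Graph α β} {f : α → ℕ} {k : ℕ}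

theorem ncard_biUnion_finset {ι γ : Type*} (s : Finset ι) (A : ι → Set γ)
    (hfin : ∀ i ∈ s, (A i).Finite)
    (hdis : ∀ i ∈ s, ∀ j ∈ s, i ≠ j → Disjoint (A i) (A j)) :
    (⋃ i ∈ s, A i).ncard = ∑ i ∈ s, (A i).ncard := by
  have := s.finite_toSet.ncard_biUnion (s := A) hfin fun i hi j hj hij => hdis i hi j hj hij
  rw [finsum_mem_coe_finset] at this
  simpa using this

theorem componentOf_eq {x y : α} (h : y ∈ componentOf G x) : componentOf G x = componentOf G y := by
  have hs : Std.Symm (Relation.ReflTransGen G.Adj) := inferInstance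
  exact Set.ext fun z => ⟨fun hz => (hs.symm _ _ h).trans hz, fun hz => Relation.ReflTransGen.trans h hz⟩

theorem mem_componentOf_self (x : α) : x ∈ componentOf G x := Relation.ReflTransGen.refl

theorem componentOf_subset {x : α} {Q : Set α} (hx : x ∈ Q)
    (hQ : ∀ y ∈ Q, ∀ z, G.Adj y z → z ∈ Q) : componentOf G x ⊆ Q := by
  intro y hy
  induction hy with
  | refl => exact hx
  | tail _ h ih => exact hQ _ ih _ h

theorem componentOf_subset_vertexSet {x : α} (hx : x ∈ V(G)) : componentOf G x ⊆ V(G) :=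
  componentOf_subset hx fun _ _ _ h => h.right_mem

theorem finite_components (hV : V(G).Finite) : (components G).Finite := hV.image _

/-- The half-edges at `v`. -/
def halfEdgesAt (G : Graph α β) (f : α → ℕ) (k : ℕ) (v : α) : Set (GadgetVertex G f k) :=
  {x | ∃ e, ∃ h : G.Inc e v, x = .inl ⟨(e, v), h⟩}

/-- The half-edges at `v` whose other half lies at a vertex of `S`. -/
def crossingHalfEdgesAt (G : Graph α β) (f : α → ℕ) (k : ℕ) (S : Set α) (v : α) :
    Set (GadgetVertex G f k) :=
  {x | ∃ e, ∃ h : G.Inc e v, ¬ (G.deleteVerts S).Inc e v ∧ x = .inl ⟨(e, v), h⟩}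

/-- The slack vertices at `v`. -/
def slackVerticesAt (G : Graph α β) (f : α → ℕ) (k : ℕ) (v : α) : Set (GadgetVertex G f k) :=
  {x | ∃ i, ∃ h : v ∈ V(G) ∧ i < degree G v - f v, x = .inr (.inl ⟨(v, i), h⟩)}

theorem ncard_halfEdgesAt (v : α) : (halfEdgesAt G f k v).ncard = degree G v := by
  symm
  refine Set.ncard_congr (fun e he => .inl ⟨(e, v), he⟩) ?_ ?_ ?_
  · exact fun e he => ⟨e, he, rfl⟩
  · intro e e' he he' h
    exact congrArg (fun x : HalfEdge G => x.1.1) (Sum.inl.inj h)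
  · rintro _ ⟨e, h, rfl⟩
    exact ⟨e, h, rfl⟩

theorem ncard_crossingHalfEdgesAt (hE : E(G).Finite) (S : Set α) (v : α) :
    (crossingHalfEdgesAt G f k S v).ncard + degree (G.deleteVerts S) v = degree G v := by
  have h1 : (crossingHalfEdgesAt G f k S v).ncard
      = (G.incidenceSet v \ (G.deleteVerts S).incidenceSet v).ncard := by
    symm
    refine Set.ncard_congr (fun e he => .inl ⟨(e, v), he.1⟩) ?_ ?_ ?_
    · exact fun e he => ⟨e, he.1, he.2, rfl⟩
    · intro e e' he he' h
      exact congrArg (fun x : HalfEdge G => x.1.1) (Sum.inl.inj h)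
    · rintro _ ⟨e, h, h', rfl⟩
      exact ⟨e, ⟨h, h'⟩, rfl⟩
  have hsub : (G.deleteVerts S).incidenceSet v ⊆ G.incidenceSet v :=
    fun e he => Graph.Inc.mono Graph.deleteVerts_le he
  rw [h1]
  exact Set.ncard_sdiff_add_ncard_of_subset hsub (finite_incidenceSet hE v)

theorem ncard_slackVerticesAt {v : α} (hv : v ∈ V(G)) :
    (slackVerticesAt G f k v).ncard = degree G v - f v := by
  have h1 : (slackVerticesAt G f k v).ncard = (Set.Iio (degree G v - f v)).ncard := by
    symm
    refine Set.ncard_congr (fun i hi => .inr (.inl ⟨(v, i), hv, hi⟩)) ?_ ?_ ?_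
    · exact fun i hi => ⟨i, ⟨hv, hi⟩, rfl⟩
    · intro i j hi hj h
      simpa using h
    · rintro _ ⟨i, h, rfl⟩
      exact ⟨i, h.2, rfl⟩
  simpa using h1

/-- Looplessness gives each edge exactly two half-edges. The last clause limits the neighbours of a
half-edge in the gadget to its partner and slack vertices. -/
theorem HalfEdge.exists_partner [G.Loopless] (p : HalfEdge G) :
    ∃ q : HalfEdge G, q.1.1 = p.1.1 ∧ q.1.2 ≠ p.1.2 ∧ G.IsLink p.1.1 p.1.2 q.1.2 ∧
      ∀ q' : HalfEdge G, q'.1.1 = p.1.1 → q' = p ∨ q' = q := by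
  obtain ⟨⟨e, v⟩, y, hy⟩ := p
  refine ⟨⟨(e, y), hy.inc_right⟩, rfl, hy.ne.symm, hy, ?_⟩
  rintro ⟨⟨e', u⟩, h⟩ rfl
  rcases h.eq_or_eq_of_isLink hy with rfl | rfl
  · exact .inl rfl
  · exact .inr rfl

theorem reachAvoid_half_half {X : Set (GadgetVertex G f k)} {p q : HalfEdge G}
    (h : p.1.1 = q.1.1) (h' : p.1.2 ≠ q.1.2) (hp : Sum.inl p ∉ X) (hq : Sum.inl q ∉ X) :
    ReachAvoid (gadget G f k) X (.inl p) (.inl q) :=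
  ReachAvoid.of_adj (H := gadget G f k) ⟨h, h'⟩ hp hq

theorem reachAvoid_half_slack {X : Set (GadgetVertex G f k)} {p : HalfEdge G}
    {b : SlackVertex G f} (h : p.1.2 = b.1.1) (hp : Sum.inl p ∉ X)
    (hb : Sum.inr (Sum.inl b) ∉ X) :
    ReachAvoid (gadget G f k) X (.inl p) (.inr (.inl b)) :=
  ReachAvoid.of_adj (H := gadget G f k) h hp hb

/-- An edge both of whose ends have all their slack vertices in `X` gives an even component. -/
theorem not_odd_ncard_compAvoid {X : Set (GadgetVertex G f k)} {p q : HalfEdge G}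
    (hqp : q.1.1 = p.1.1) (hne : q.1.2 ≠ p.1.2)
    (huniq : ∀ q' : HalfEdge G, q'.1.1 = p.1.1 → q' = p ∨ q' = q)
    (hp : Sum.inl p ∉ X) (hq : Sum.inl q ∉ X)
    (hpX : ∀ b : SlackVertex G f, p.1.2 = b.1.1 → Sum.inr (Sum.inl b) ∈ X)
    (hqX : ∀ b : SlackVertex G f, q.1.2 = b.1.1 → Sum.inr (Sum.inl b) ∈ X) :
    ¬ Odd (compAvoid (gadget G f k) X (.inl p)).ncard := by
  have hcomp : compAvoid (gadget G f k) X (.inl p) = {.inl p, .inl q} := by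
    apply Set.Subset.antisymm
    · apply compAvoid_subset (by simp)
      rintro y hy (q' | b | w) hadj hyX hzX
      · rcases hy with rfl | rfl
        · rcases huniq q' hadj.1.symm with rfl | rfl <;> simp
        · rcases huniq q' (hadj.1.symm.trans hqp) with rfl | rfl <;> simp
      · rcases hy with rfl | rfl
        · exact absurd (hpX b hadj) hzX
        · exact absurd (hqX b hadj) hzX
      · rcases hy with rfl | rfl <;> exact hadj.elim
    · rintro y (rfl | rfl)
      · exact mem_compAvoid_self _
      · exact ReachAvoid.of_adj (H := gadget G f k) ⟨hqp.symm, hne.symm⟩ hp hq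
  have hpq : (Sum.inl p : GadgetVertex G f k) ≠ .inl q := fun h =>
    hne (congrArg (fun x : HalfEdge G => x.1.2) (Sum.inl.inj h)).symm
  rw [hcomp, Set.ncard_pair hpq]
  decide

/-- A barrier of the gadget graph contains every apex. -/
theorem apex_mem_of_barrier [G.Loopless] (hk : k ≤ 1) {X : Set (GadgetVertex G f k)}
    (hX : X.ncard + 2 ≤ (oddCompsAvoid (gadget G f k) X).ncard)
    (hX3 : ∀ x ∈ X, ∀ a b, ∃ y, y ∉ X ∧ (gadget G f k).Adj x y ∧
      ¬ ReachAvoid (gadget G f k) X a y ∧ ¬ ReachAvoid (gadget G f k) X b y) (w : Fin k) :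
    Sum.inr (Sum.inr w) ∈ X := by
  by_contra hw
  have hww : ∀ w' : Fin k, w' = w := fun w' => Fin.ext (by omega)
  have hBw : ∀ b, Sum.inr (Sum.inl b) ∉ X →
      ReachAvoid (gadget G f k) X (.inr (.inr w)) (.inr (.inl b)) :=
    fun b hb => ReachAvoid.of_adj (H := gadget G f k) trivial hw hb
  have hAB : ∀ (p : HalfEdge G) (b : SlackVertex G f), p.1.2 = b.1.1 → Sum.inl p ∉ X →
      Sum.inr (Sum.inl b) ∉ X → ReachAvoid (gadget G f k) X (.inr (.inr w)) (.inl p) :=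
    fun p b hpb hp hb => (hBw b hb).trans (ReachAvoid.of_adj (H := gadget G f k) hpb hb hp)
  -- A half-edge sees only its partner and slack vertices; the surviving slack vertices all lie in
  -- the component of `w`. Two components are too few for a barrier vertex.
  have hA : ∀ p : HalfEdge G, Sum.inl p ∉ X := by
    intro p hp
    obtain ⟨q, hqp, hne, -, huniq⟩ := p.exists_partner
    obtain ⟨y, hyX, hadj, hy1, hy2⟩ := hX3 _ hp (.inl q) (.inr (.inr w))
    rcases y with q' | b | w'
    · rcases huniq q' hadj.1.symm with rfl | rfl
      · exact hadj.2 rfl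
      · exact hy1 Relation.ReflTransGen.refl
    · exact hy2 (hBw b hyX)
    · exact hadj.elim
  have hB : ∀ b c : SlackVertex G f, Sum.inr (Sum.inl b) ∈ X → b.1.1 = c.1.1 →
      Sum.inr (Sum.inl c) ∈ X := by
    intro b c hb hbc
    by_contra hc
    obtain ⟨y, hyX, hadj, hy1, -⟩ := hX3 _ hb (.inr (.inr w)) (.inr (.inr w))
    rcases y with p | b | w'
    · exact hy1 (hAB p c (Eq.trans hadj hbc) hyX hc)
    · exact hadj.elim
    · rw [hww w'] at hy1
      exact hy1 Relation.ReflTransGen.refl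
  -- Whatever is not joined to `w` is a pair of half-edges, an even component, so at most one
  -- component is odd.
  have hsub : oddCompsAvoid (gadget G f k) X ⊆ {compAvoid (gadget G f k) X (.inr (.inr w))} := by
    rintro _ ⟨x, hx, rfl, hodd⟩
    rw [Set.mem_singleton_iff]
    suffices h : ReachAvoid (gadget G f k) X (.inr (.inr w)) x from (compAvoid_eq h).symm
    rcases x with p | b | w'
    · by_contra hnot
      obtain ⟨q, hqp, hne, -, huniq⟩ := p.exists_partner
      refine not_odd_ncard_compAvoid hqp hne huniq hx (hA q) ?_ ?_ hodd
      · intro b hb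
        by_contra hbX
        exact hnot (hAB p b hb hx hbX)
      · intro b hb
        by_contra hbX
        exact hnot ((hAB q b hb (hA q) hbX).trans
          (ReachAvoid.of_adj (H := gadget G f k) ⟨hqp, hne⟩ (hA q) hx))
    · exact hBw b hx
    · rw [hww w']
      exact Relation.ReflTransGen.refl
  have := Set.ncard_le_ncard hsub (Set.finite_singleton _)
  rw [Set.ncard_singleton] at this
  omega

/-- A barrier of the gadget graph that contains every apex yields disjoint sets `S` and `T` of
vertices violating the degree condition. -/
theorem exists_violation_of_barrier [G.Loopless] (hV : V(G).Finite) (hE : E(G).Finite)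
    (hf : ∀ v ∈ V(G), f v ≤ degree G v)
    {X : Set (GadgetVertex G f k)}
    (hX : X.ncard + 2 ≤ (oddCompsAvoid (gadget G f k) X).ncard)
    (hX3 : ∀ x ∈ X, ∀ a b, ∃ y, y ∉ X ∧ (gadget G f k).Adj x y ∧
      ¬ ReachAvoid (gadget G f k) X a y ∧ ¬ ReachAvoid (gadget G f k) X b y)
    (hw : ∀ w : Fin k, Sum.inr (Sum.inr w) ∈ X) :
    ∃ S T : Finset α, (S : Set α) ⊆ V(G) ∧ (T : Set α) ⊆ V(G) ∧ Disjoint S T ∧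
      ∑ x ∈ S, f x + ∑ x ∈ T, degree (G.deleteVerts (S : Set α)) x + 2 ≤
        ∑ x ∈ T, f x + numComponents (G.deleteVerts ((S : Set α) ∪ (T : Set α))) := by
  classical
  have := finite_halfEdge hV hE
  have := finite_slackVertex (f := f) hV
  have hXfin : X.Finite := Set.toFinite _
  -- It will turn out that `X` consists of the half-edges at `S`, the slack vertices at `T` and the
  -- apices. A vertex without half-edges falls into `S`, and one outside `S` without slack vertices
  -- into `T`, vacuously.
  set S : Finset α := hV.toFinset.filter fun v => ∀ e, ∀ h : G.Inc e v, Sum.inl ⟨(e, v), h⟩ ∈ X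
    with hS
  set T : Finset α := hV.toFinset.filter fun v => v ∉ S ∧
    ∀ i, ∀ h : v ∈ V(G) ∧ i < degree G v - f v, Sum.inr (Sum.inl ⟨(v, i), h⟩) ∈ X with hT
  have hSV : (S : Set α) ⊆ V(G) := fun v hv => by
    have := (Finset.mem_filter.1 (Finset.mem_coe.1 hv)).1
    simpa using this
  have hTV : (T : Set α) ⊆ V(G) := fun v hv => by
    have := (Finset.mem_filter.1 (Finset.mem_coe.1 hv)).1
    simpa using this
  have hST : Disjoint S T := Finset.disjoint_left.2 fun v hv hv' =>
    (Finset.mem_filter.1 hv').2.1 hv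
  have hSmem : ∀ p : HalfEdge G, p.1.2 ∈ S → Sum.inl p ∈ X := fun p hp =>
    (Finset.mem_filter.1 hp).2 p.1.1 p.2
  have hTmem : ∀ b : SlackVertex G f, b.1.1 ∈ T → Sum.inr (Sum.inl b) ∈ X := fun b hb =>
    (Finset.mem_filter.1 hb).2.2 b.1.2 b.2
  have hnS : ∀ v ∈ V(G), v ∉ S → ∃ p : HalfEdge G, p.1.2 = v ∧ Sum.inl p ∉ X := by
    intro v hv hvS
    rw [hS, Finset.mem_filter] at hvS
    push Not at hvS
    obtain ⟨e, h, he⟩ := hvS (by simpa using hv)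
    exact ⟨_, rfl, he⟩
  have hnT : ∀ v ∈ V(G), v ∉ S → v ∉ T →
      ∃ b : SlackVertex G f, b.1.1 = v ∧ Sum.inr (Sum.inl b) ∉ X := by
    intro v hv hvS hvT
    rw [hT, Finset.mem_filter] at hvT
    push Not at hvT
    obtain ⟨i, h, hi⟩ := hvT (by simpa using hv) hvS
    exact ⟨_, rfl, hi⟩
  have hA : ∀ p : HalfEdge G, p.1.2 ∉ S → Sum.inl p ∉ X := by
    intro p hpS hp
    obtain ⟨p₀, hp₀, hp₀X⟩ := hnS _ p.2.vertex_mem hpS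
    obtain ⟨q, hqp, hne, -, huniq⟩ := p.exists_partner
    obtain ⟨y, hyX, hadj, hy1, hy2⟩ := hX3 _ hp (.inl q) (.inl p₀)
    rcases y with q' | b | w'
    · rcases huniq q' hadj.1.symm with rfl | rfl
      · exact hadj.2 rfl
      · exact hy1 Relation.ReflTransGen.refl
    · exact hy2 (ReachAvoid.of_adj (H := gadget G f k) (hp₀.trans hadj) hp₀X hyX)
    · exact hadj.elim
  -- At a vertex of `S` all neighbours of a slack vertex lie in `X`, whereas a barrier vertex has
  -- neighbours outside. Outside `S`, one surviving slack vertex `c` would put all surviving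
  -- neighbours of `b` into one component.
  have hBT : ∀ b : SlackVertex G f, Sum.inr (Sum.inl b) ∈ X → b.1.1 ∉ S ∧ b.1.1 ∈ T := by
    intro b hb
    have hbS : b.1.1 ∉ S := by
      intro hbS
      obtain ⟨y, hyX, hadj, -, -⟩ := hX3 _ hb (.inr (.inl b)) (.inr (.inl b))
      rcases y with p | b | w'
      · exact hyX (hSmem p (by rw [show p.1.2 = b.1.1 from hadj]; exact hbS))
      · exact hadj.elim
      · exact hyX (hw w')
    refine ⟨hbS, ?_⟩
    by_contra hbT
    obtain ⟨c, hc, hcX⟩ := hnT _ b.2.1 hbS hbT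
    obtain ⟨y, hyX, hadj, hy1, -⟩ := hX3 _ hb (.inr (.inl c)) (.inr (.inl c))
    rcases y with p | b | w'
    · exact hy1 (ReachAvoid.of_adj (H := gadget G f k) (Eq.trans hadj hc.symm) hcX hyX)
    · exact hadj.elim
    · exact hyX (hw w')
  set G' := G.deleteVerts ((S : Set α) ∪ (T : Set α)) with hG'
  have hreach0 : ∀ b c : SlackVertex G f, b.1.1 = c.1.1 → b.1.1 ∉ S → b.1.1 ∉ T →
      ReachAvoid (gadget G f k) X (.inr (.inl b)) (.inr (.inl c)) := by
    intro b c hbc hbS hbT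
    obtain ⟨p, hp, hpX⟩ := hnS _ b.2.1 hbS
    have hbX : Sum.inr (Sum.inl b) ∉ X := fun h => hbT (hBT b h).2
    have hcX : Sum.inr (Sum.inl c) ∉ X := fun h => hbT (hbc ▸ (hBT c h).2)
    exact (reachAvoid_half_slack hp hpX hbX).symm.trans
      (reachAvoid_half_slack (hp.trans hbc) hpX hcX)
  have hreach : ∀ (b : SlackVertex G f) (u : α), b.1.1 ∉ S → b.1.1 ∉ T →
      u ∈ componentOf G' b.1.1 → ∀ c : SlackVertex G f, c.1.1 = u →
      ReachAvoid (gadget G f k) X (.inr (.inl b)) (.inr (.inl c)) := by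
    intro b u hbS hbT hu
    induction hu with
    | refl => exact fun c hc => hreach0 b c hc.symm hbS hbT
    | @tail y z _ hyz ih =>
      intro c hc
      obtain ⟨e, he⟩ := hyz
      rw [hG', Graph.deleteVerts_isLink] at he
      obtain ⟨he, hyST, hzST⟩ := he
      simp only [Set.mem_union, Finset.mem_coe, not_or] at hyST hzST
      obtain ⟨b', hb', hbX'⟩ := hnT y he.left_mem hyST.1 hyST.2
      have hcX : Sum.inr (Sum.inl c) ∉ X := fun h => hzST.2 (hc ▸ (hBT c h).2)
      have hyX := hA ⟨(e, y), he.inc_left⟩ hyST.1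
      have hzX := hA ⟨(e, z), he.inc_right⟩ hzST.1
      exact (ih b' hb').trans
        ((reachAvoid_half_slack hb'.symm hyX hbX').symm.trans
          ((reachAvoid_half_half (p := ⟨(e, y), he.inc_left⟩)
            (q := ⟨(e, z), he.inc_right⟩) rfl he.ne hyX hzX).trans
            (reachAvoid_half_slack hc.symm hzX hcX)))
  -- Each vertex outside `S ∪ T` keeps a slack vertex and all its half-edges, so the slack vertices
  -- of one component `K` of `G'` lie in a single gadget component, namely `Φ K`.
  set Φ : Set α → Set (GadgetVertex G f k) := fun K =>
    {y | ∃ b : SlackVertex G f, b.1.1 ∈ K ∧ y ∈ compAvoid (gadget G f k) X (.inr (.inl b))} with hΦ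
  have hΦc : ∀ b : SlackVertex G f, b.1.1 ∉ S → b.1.1 ∉ T →
      compAvoid (gadget G f k) X (.inr (.inl b)) ∈ Φ '' components G' := by
    intro b hbS hbT
    refine ⟨componentOf G' b.1.1, ⟨b.1.1, ?_, rfl⟩, ?_⟩
    · rw [hG', Graph.vertexSet_deleteVerts]
      exact ⟨b.2.1, by simp [hbS, hbT]⟩
    · apply Set.Subset.antisymm
      · rintro y ⟨c, hc, hy⟩
        exact (hreach b _ hbS hbT hc c rfl).trans hy
      · exact fun y hy => ⟨b, mem_componentOf_self _, hy⟩
  -- The odd components come from slack vertices at `S`, from half-edges at `T` whose partner is at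
  -- `S`, and from components of `G'`. An edge inside `T` gives an even pair.
  have hcover : oddCompsAvoid (gadget G f k) X ⊆
      (compAvoid (gadget G f k) X '' ⋃ v ∈ S, slackVerticesAt G f k v) ∪
        (compAvoid (gadget G f k) X '' ⋃ v ∈ T, crossingHalfEdgesAt G f k S v) ∪ Φ '' components G' := by
    rintro _ ⟨x, hx, rfl, hodd⟩
    rcases x with p | b | w
    · have hpS : p.1.2 ∉ S := fun h => hx (hSmem p h)
      by_cases hpT : p.1.2 ∈ T
      · obtain ⟨q, hqp, hne, hlink, huniq⟩ := p.exists_partner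
        by_cases hqS : q.1.2 ∈ S
        · refine .inl (.inr ⟨_, Set.mem_biUnion (Finset.mem_coe.2 hpT) ⟨p.1.1, p.2, ?_, rfl⟩, rfl⟩)
          rintro ⟨y, hy⟩
          rw [Graph.deleteVerts_isLink] at hy
          rw [hlink.right_unique hy.1] at hqS
          exact hy.2.2 hqS
        · have hqX := hA q hqS
          by_cases hqT : q.1.2 ∈ T
          · exact absurd hodd (not_odd_ncard_compAvoid hqp hne huniq hx hqX
              (fun b hb => hTmem b (hb ▸ hpT)) (fun b hb => hTmem b (hb ▸ hqT)))
          · obtain ⟨b, hb, hbX⟩ := hnT _ q.2.vertex_mem hqS hqT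
            have h := hΦc b (hb ▸ hqS) (hb ▸ hqT)
            rw [compAvoid_eq ((reachAvoid_half_half hqp.symm hne.symm hx hqX).trans
              (reachAvoid_half_slack hb.symm hqX hbX))]
            exact .inr h
      · obtain ⟨b, hb, hbX⟩ := hnT _ p.2.vertex_mem hpS hpT
        have h := hΦc b (hb ▸ hpS) (hb ▸ hpT)
        rw [compAvoid_eq (reachAvoid_half_slack hb.symm hx hbX)]
        exact .inr h
    · by_cases hbS : b.1.1 ∈ S
      · exact .inl (.inl ⟨_, Set.mem_biUnion (Finset.mem_coe.2 hbS) ⟨b.1.2, b.2, rfl⟩, rfl⟩)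
      · exact .inr (hΦc b hbS fun h => hx (hTmem b h))
    · exact absurd (hw w) hx
  have hle : (oddCompsAvoid (gadget G f k) X).ncard ≤
      ∑ v ∈ S, (slackVerticesAt G f k v).ncard +
        ∑ v ∈ T, (crossingHalfEdgesAt G f k S v).ncard + numComponents G' := by
    have hfin : V(G').Finite := hV.subset (by simp [hG'])
    refine (Set.ncard_le_ncard hcover ?_).trans ((Set.ncard_union_le _ _).trans
      (add_le_add ((Set.ncard_union_le _ _).trans (add_le_add ?_ ?_)) ?_))
    · exact ((Set.toFinite _).union (Set.toFinite _)).union ((finite_components hfin).image _)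
    · exact (Set.ncard_image_le (Set.toFinite _)).trans (Finset.set_ncard_biUnion_le _ _)
    · exact (Set.ncard_image_le (Set.toFinite _)).trans (Finset.set_ncard_biUnion_le _ _)
    · exact Set.ncard_image_le (finite_components hfin)
  -- The apices in `X` are simply discarded from the lower bound.
  have hge : ∑ v ∈ S, degree G v + ∑ v ∈ T, (slackVerticesAt G f k v).ncard ≤ X.ncard := by
    have hd1 : ∀ u ∈ S, ∀ v ∈ S, u ≠ v →
        Disjoint (halfEdgesAt G f k u) (halfEdgesAt G f k v) := by
      intro u _ v _ huv
      rw [Set.disjoint_left]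
      rintro _ ⟨e, h, rfl⟩ ⟨e', h', heq⟩
      exact huv (congrArg (fun x : HalfEdge G => x.1.2) (Sum.inl.inj heq))
    have hd2 : ∀ u ∈ T, ∀ v ∈ T, u ≠ v →
        Disjoint (slackVerticesAt G f k u) (slackVerticesAt G f k v) := by
      intro u _ v _ huv
      rw [Set.disjoint_left]
      rintro _ ⟨i, h, rfl⟩ ⟨j, h', heq⟩
      exact huv (congrArg (fun x : SlackVertex G f => x.1.1) (Sum.inl.inj (Sum.inr.inj heq)))
    rw [← ncard_biUnion_finset T _ (fun _ _ => Set.toFinite _) hd2,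
      ← Finset.sum_congr rfl (fun v _ => ncard_halfEdgesAt (G := G) (f := f) (k := k) v),
      ← ncard_biUnion_finset S _ (fun _ _ => Set.toFinite _) hd1, ← Set.ncard_union_eq]
    · refine Set.ncard_le_ncard (Set.union_subset ?_ ?_) hXfin
      · refine Set.iUnion₂_subset fun v hv => ?_
        rintro _ ⟨e, h, rfl⟩
        exact hSmem _ hv
      · refine Set.iUnion₂_subset fun v hv => ?_
        rintro _ ⟨e, h, rfl⟩
        exact hTmem _ hv
    · simp only [Set.disjoint_left, Set.mem_iUnion]
      rintro _ ⟨v, _, e, h, rfl⟩ ⟨u, _, i, h', heq⟩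
      cases heq
  refine ⟨S, T, hSV, hTV, hST, ?_⟩
  have hS1 : ∑ v ∈ S, (slackVerticesAt G f k v).ncard + ∑ v ∈ S, f v = ∑ v ∈ S, degree G v := by
    rw [← Finset.sum_add_distrib]
    refine Finset.sum_congr rfl fun v hv => ?_
    have := hf v (hSV hv)
    rw [ncard_slackVerticesAt (hSV hv)]
    omega
  have hT1 : ∑ v ∈ T, (slackVerticesAt G f k v).ncard + ∑ v ∈ T, f v = ∑ v ∈ T, degree G v := by
    rw [← Finset.sum_add_distrib]
    refine Finset.sum_congr rfl fun v hv => ?_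
    have := hf v (hTV hv)
    rw [ncard_slackVerticesAt (hTV hv)]
    omega
  have hT2 : ∑ v ∈ T, (crossingHalfEdgesAt G f k S v).ncard
      + ∑ v ∈ T, degree (G.deleteVerts (S : Set α)) v = ∑ v ∈ T, degree G v := by
    rw [← Finset.sum_add_distrib]
    exact Finset.sum_congr rfl fun v _ => ncard_crossingHalfEdgesAt hE S v
  change (oddCompsAvoid (gadget G f k) X).ncard ≤ _ + _ + numComponents (G.deleteVerts _) at hle
  omega

/-- A sufficient condition for a near factor, in terms of disjoint sets `S` and `T` of vertices. -/
theorem hasNearFactor_of_forall_disjoint [G.Loopless] (hV : V(G).Finite) (hE : E(G).Finite)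
    (hf : ∀ v ∈ V(G), f v ≤ degree G v)
    (h : ∀ S T : Finset α, (S : Set α) ⊆ V(G) → (T : Set α) ⊆ V(G) → Disjoint S T →
      ∑ x ∈ T, f x + numComponents (G.deleteVerts ((S : Set α) ∪ (T : Set α))) ≤
        ∑ x ∈ S, f x + ∑ x ∈ T, degree (G.deleteVerts (S : Set α)) x + 1) :
    HasNearFactor G f := by
  have := finite_halfEdge hV hE
  have := finite_slackVertex (f := f) hV
  obtain ⟨k, hk, heven⟩ : ∃ k ≤ 1, Even (Nat.card (GadgetVertex G f k)) := by
    refine ⟨(Nat.card (HalfEdge G) + Nat.card (SlackVertex G f)) % 2, by omega, ?_⟩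
    rw [Nat.card_sum, Nat.card_sum, Nat.card_fin, Nat.even_iff]
    omega
  by_contra hno
  obtain ⟨X, hX, hX3⟩ := exists_barrier (gadget G f k) heven
    fun ⟨M, hM⟩ => hno (hasNearFactor_of_isPerfectMatching hE hf hk hM)
  obtain ⟨S, T, hS, hT, hST, hlt⟩ := exists_violation_of_barrier hV hE hf hX hX3
    (apex_mem_of_barrier hk hX hX3)
  have := h S T hS hT hST
  omega

end NearFactorCriterion

/-! ### Greedy independent sets and star center sets. -/

section StarCenters

variable {α : Type*} {β : Type*} {G : Graph α β}

/-- A maximal independent set chosen greedily with respect to a weight. -/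
theorem exists_independent_dominating {γ : Type*} (r : γ → γ → Prop) (hsymm : ∀ x y, r x y → r y x)
    (hirr : ∀ x, ¬ r x x) (g : γ → ℕ) (s : Finset γ) :
    ∃ I ⊆ s, (∀ x ∈ I, ∀ y ∈ I, ¬ r x y) ∧ ∀ y ∈ s, ∃ x ∈ I, (y = x ∨ r x y) ∧ g y ≤ g x := by
  classical
  induction s using Finset.strongInduction with | _ s ih =>
  rcases s.eq_empty_or_nonempty with rfl | hs
  · exact ⟨∅, by simp⟩
  obtain ⟨x, hx, hmax⟩ := s.exists_max_image g hs
  -- A heaviest element `x` dominates itself and its neighbours; the recursion handles the rest.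
  obtain ⟨I, hI, hind, hdom⟩ := ih (s.filter fun y => y ≠ x ∧ ¬ r x y)
    (Finset.filter_ssubset.2 ⟨x, hx, by simp⟩)
  refine ⟨insert x I, ?_, ?_, ?_⟩
  · exact Finset.insert_subset hx (hI.trans (Finset.filter_subset _ _))
  · have hxI : ∀ y ∈ I, ¬ r x y := fun y hy => (Finset.mem_filter.1 (hI hy)).2.2
    intro y hy z hz
    rcases Finset.mem_insert.1 hy with hy | hy <;> rcases Finset.mem_insert.1 hz with hz | hz
    · rw [hy, hz]
      exact hirr _
    · exact hy ▸ hxI z hz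
    · exact fun h => hxI y hy (hsymm _ _ (hz ▸ h))
    · exact hind y hy z hz
  · intro y hy
    by_cases h : y ≠ x ∧ ¬ r x y
    · obtain ⟨z, hz, h1⟩ := hdom y (Finset.mem_filter.2 ⟨hy, h⟩)
      exact ⟨z, Finset.mem_insert_of_mem hz, h1⟩
    · refine ⟨x, Finset.mem_insert_self _ _, ?_, hmax y hy⟩
      by_contra h'
      push Not at h'
      exact h h'

theorem card_le_numComponents (hV : V(G).Finite) (P : Finset α) (hP : ∀ x ∈ P, x ∈ V(G))
    (hsep : ∀ x ∈ P, ∀ y ∈ P, y ∈ componentOf G x → x = y) : P.card ≤ numComponents G := by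
  have hinj : Set.InjOn (componentOf G) P := fun x hx y hy hxy =>
    hsep x hx y hy (hxy ▸ mem_componentOf_self y)
  rw [← Set.ncard_coe_finset, ← hinj.ncard_image]
  refine Set.ncard_le_ncard ?_ (finite_components hV)
  rintro _ ⟨x, hx, rfl⟩
  exact ⟨x, hP x hx, rfl⟩

theorem componentOf_of_isolated {x : α} (hx : x ∈ isolatedVertices G) : componentOf G x = {x} := by
  apply Set.Subset.antisymm
  · refine componentOf_subset rfl ?_
    rintro y rfl z ⟨e, he⟩
    have : e ∈ G.incidenceSet y := he.inc_left
    rw [hx.2] at this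
    exact this.elim
  · rintro y rfl
    exact mem_componentOf_self y

theorem isStarCenter_of_isolated {x : α} (hx : x ∈ isolatedVertices G) : IsStarCenter G x where
  mem := hx.1
  existsUnique_isLink y hy hne := by
    rw [componentOf_of_isolated hx] at hy
    exact absurd hy hne
  eq_or_eq e y z hy h := by
    rw [componentOf_of_isolated hx] at hy
    exact .inl hy

/-- Centers of different star components extend to a star center set. -/
theorem exists_isStarCenterSet {P : Set α} (hP : ∀ x ∈ P, IsStarCenter G x)
    (hsep : ∀ x ∈ P, ∀ y ∈ P, y ∈ componentOf G x → x = y) : ∃ I, IsStarCenterSet G I ∧ P ⊆ I := by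
  classical
  -- In each star component the representative is the element of `P` if there is one, and any center
  -- otherwise.
  have hex : ∀ K : {K : Set α // ∃ c, IsStarCenter G c ∧ componentOf G c = K},
      ∃ r, (IsStarCenter G r ∧ componentOf G r = K) ∧ ∀ x ∈ P, componentOf G x = K → x = r := by
    rintro ⟨K, hK⟩
    by_cases h : ∃ x ∈ P, componentOf G x = K
    · obtain ⟨x, hx, rfl⟩ := h
      exact ⟨x, ⟨hP x hx, rfl⟩, fun y hy hyx => hsep y hy x hx (hyx ▸ mem_componentOf_self x)⟩
    · obtain ⟨c, hc⟩ := hK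
      exact ⟨c, hc, fun y hy hyx => absurd ⟨y, hy, hyx⟩ h⟩
  choose r hr hrP using hex
  refine ⟨Set.range r, ⟨?_, ?_⟩, ?_⟩
  · rintro _ ⟨K, rfl⟩
    exact (hr K).1
  · intro c hc
    have hrc := hr ⟨_, c, hc, rfl⟩
    refine ⟨r ⟨_, c, hc, rfl⟩, ⟨⟨_, rfl⟩, ?_⟩, ?_⟩
    · have := mem_componentOf_self (G := G) (r ⟨_, c, hc, rfl⟩)
      rwa [hrc.2] at this
    · rintro _ ⟨⟨K, rfl⟩, hK⟩
      congr 1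
      exact Subtype.ext ((hr K).2.symm.trans (componentOf_eq hK).symm)
  · exact fun x hx => ⟨⟨_, x, hP x hx, rfl⟩, (hrP ⟨_, x, hP x hx, rfl⟩ x hx rfl).symm⟩

end StarCenters

/-! ### Edge counts around an independent set. -/

section Counting

variable {α : Type*} {β : Type*} {G : Graph α β}

/-- The neighbors of `x` in `G` outside `S`. -/
noncomputable def nbrs (G : Graph α β) (hV : V(G).Finite) (S : Finset α) (x : α) : Finset α :=
  (hV.subset (t := {y | y ∉ S ∧ G.Adj x y}) fun _ hy => hy.2.right_mem).toFinset

theorem mem_nbrs {hV : V(G).Finite} {S : Finset α} {x y : α} :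
    y ∈ nbrs G hV S x ↔ y ∉ S ∧ G.Adj x y := by
  rw [nbrs, Set.Finite.mem_toFinset]
  exact Iff.rfl

theorem finite_incidenceSet_deleteVerts (hE : E(G).Finite) (S : Set α) (x : α) :
    ((G.deleteVerts S).incidenceSet x).Finite :=
  (finite_incidenceSet hE x).subset fun _ he => Graph.Inc.mono Graph.deleteVerts_le he

/-- Different neighbours use different edges; parallel edges can make the inequality strict. -/
theorem card_nbrs_le (hV : V(G).Finite) (hE : E(G).Finite) {S : Finset α} {x : α} (hx : x ∉ S) :
    (nbrs G hV S x).card ≤ degree (G.deleteVerts (S : Set α)) x := by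
  classical
  have hex : ∀ y ∈ nbrs G hV S x, ∃ e, (G.deleteVerts (S : Set α)).IsLink e x y := by
    intro y hy
    obtain ⟨hyS, e, he⟩ := mem_nbrs.1 hy
    exact ⟨e, by simpa using ⟨he, hx, hyS⟩⟩
  rcases isEmpty_or_nonempty β with hβ | hβ
  · rw [Finset.card_eq_zero.2 (Finset.eq_empty_of_forall_notMem fun y hy =>
      hβ.elim (hex y hy).choose)]
    exact Nat.zero_le _
  choose! e he using hex
  rw [← Set.ncard_coe_finset]
  refine Set.ncard_le_ncard_of_injOn e (fun y hy => (he y hy).inc_left) ?_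
    (finite_incidenceSet_deleteVerts hE _ x)
  intro y hy z hz hyz
  have h := he z hz
  rw [← hyz] at h
  exact (he y hy).right_unique h

/-- Counting the edges that leave an independent set `I`: each vertex of `A` takes one edge, and
each member of `Z` takes one edge at a vertex outside `A` or a second one at a vertex of `A`. -/
theorem card_add_card_le_sum_degree (hV : V(G).Finite) (hE : E(G).Finite) {ι : Type*}
    {S I A : Finset α} (hIS : Disjoint I S) (hI : ∀ x ∈ I, ∀ y ∈ I, ¬ G.Adj x y)
    (hA : ∀ y ∈ A, ∃ x ∈ I, y ∈ nbrs G hV S x) (Z : Finset ι) (c : ι → α)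
    (hc : Set.InjOn c Z) (hcN : ∀ i ∈ Z, ∃ x ∈ I, c i ∈ nbrs G hV S x)
    (hcA : ∀ i ∈ Z, c i ∈ A → ¬ ∃! e, ∃ x ∈ I, G.IsLink e x (c i)) :
    A.card + Z.card ≤ ∑ x ∈ I, degree (G.deleteVerts (S : Set α)) x := by
  classical
  have hIS' : ∀ x ∈ I, x ∉ S := fun x hx => Finset.disjoint_left.1 hIS hx
  have h1 : ∀ y ∈ A, ∃ e, ∃ x ∈ I, G.IsLink e x y ∧ y ∉ S := by
    intro y hy
    obtain ⟨x, hx, hxy⟩ := hA y hy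
    obtain ⟨hyS, e, he⟩ := mem_nbrs.1 hxy
    exact ⟨e, x, hx, he, hyS⟩
  rcases isEmpty_or_nonempty β with hβ | hβ
  · rw [Finset.card_eq_zero.2 (Finset.eq_empty_of_forall_notMem fun y hy =>
      hβ.elim (h1 y hy).choose), Finset.card_eq_zero.2 (Finset.eq_empty_of_forall_notMem
      fun i hi => ?_)]
    · exact Nat.zero_le _
    · obtain ⟨x, -, hx⟩ := hcN i hi
      exact hβ.elim (mem_nbrs.1 hx).2.choose
  choose! e₁ he₁ using h1
  -- When `c i` lies in `A`, its edge from `I` is not unique, so a second one avoids `e₁ (c i)`.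
  have h2 : ∀ i ∈ Z, ∃ e, (∃ x ∈ I, G.IsLink e x (c i) ∧ c i ∉ S) ∧ (c i ∈ A → e ≠ e₁ (c i)) := by
    intro i hi
    obtain ⟨x, hx, hxy⟩ := hcN i hi
    obtain ⟨hyS, e, he⟩ := mem_nbrs.1 hxy
    by_cases hiA : c i ∈ A
    · have hno := hcA i hi hiA
      by_contra! hall
      refine hno ⟨e₁ (c i), ?_, ?_⟩
      · obtain ⟨x, hx, h, -⟩ := he₁ _ hiA
        exact ⟨x, hx, h⟩
      · rintro e' ⟨x', hx', he'⟩
        exact (hall e' ⟨x', hx', he', hyS⟩).2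
    · exact ⟨e, ⟨x, hx, he, hyS⟩, fun h => absurd h hiA⟩
  choose! e₂ he₂ he₂' using h2
  -- Independence of `I` determines the end of an edge outside `I`, so no edge is charged to two
  -- vertices.
  have hend : ∀ e x y x' y', x ∈ I → x' ∈ I → G.IsLink e x y → G.IsLink e x' y' → y = y' := by
    intro e x y x' y' hx hx' h h'
    rcases h.eq_and_eq_or_eq_and_eq h' with h3 | h3
    · exact h3.2
    · exact absurd ⟨e, h3.2 ▸ h⟩ (hI x hx x' hx')
  have hinj₁ : Set.InjOn e₁ A := by
    intro y hy z hz hyz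
    obtain ⟨x, hx, h, -⟩ := he₁ y hy
    obtain ⟨x', hx', h', -⟩ := he₁ z hz
    exact hend _ _ _ _ _ hx hx' h (hyz ▸ h')
  have hinj₂ : Set.InjOn e₂ Z := by
    intro i hi j hj hij
    obtain ⟨x, hx, h, -⟩ := he₂ i hi
    obtain ⟨x', hx', h', -⟩ := he₂ j hj
    exact hc hi hj (hend _ _ _ _ _ hx hx' h (hij ▸ h'))
  have hdis : Disjoint (A.image e₁) (Z.image e₂) := by
    rw [Finset.disjoint_left]
    intro e he he'
    obtain ⟨y, hy, rfl⟩ := Finset.mem_image.1 he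
    obtain ⟨i, hi, hiy⟩ := Finset.mem_image.1 he'
    obtain ⟨x, hx, h, -⟩ := he₁ y hy
    obtain ⟨x', hx', h', -⟩ := he₂ i hi
    have hyc : y = c i := hend _ _ _ _ _ hx hx' h (hiy ▸ h')
    subst hyc
    exact he₂' i hi hy hiy
  rw [← Finset.card_image_of_injOn hinj₁, ← Finset.card_image_of_injOn hinj₂,
    ← Finset.card_union_of_disjoint hdis, ← Set.ncard_coe_finset]
  refine le_trans (Set.ncard_le_ncard ?_ ?_) (Finset.set_ncard_biUnion_le I
    fun x => (G.deleteVerts (S : Set α)).incidenceSet x)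
  · intro e he
    rw [Finset.mem_coe, Finset.mem_union, Finset.mem_image, Finset.mem_image] at he
    have : ∃ x ∈ I, ∃ y, G.IsLink e x y ∧ y ∉ S := by
      rcases he with ⟨y, hy, rfl⟩ | ⟨i, hi, rfl⟩
      · obtain ⟨x, hx, h⟩ := he₁ y hy
        exact ⟨x, hx, y, h⟩
      · obtain ⟨x, hx, h⟩ := he₂ i hi
        exact ⟨x, hx, _, h⟩
    obtain ⟨x, hx, y, h, hyS⟩ := this
    exact Set.mem_biUnion (Finset.mem_coe.2 hx) ⟨y, by simpa using ⟨h, hIS' x hx, hyS⟩⟩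
  · exact I.finite_toSet.biUnion fun x _ => finite_incidenceSet_deleteVerts hE _ x

/-- The weight of a set dominated by `I`. -/
theorem sum_add_sum_card_le (hV : V(G).Finite) (hE : E(G).Finite) {S T' U I : Finset α}
    (g : α → ℕ) (hTS : Disjoint T' S) (hTU : Disjoint T' U)
    (hIT : I ⊆ T') (hg : ∀ x ∈ I, 0 < g x)
    (hdom : ∀ y ∈ T', ∃ x ∈ I, (y = x ∨ G.Adj x y) ∧ g y ≤ g x) [DecidableEq α] :
    ∑ x ∈ T', g x + ∑ x ∈ I, (nbrs G hV S x ∩ U).card ≤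
      ∑ x ∈ I, g x * (1 + degree (G.deleteVerts (S : Set α)) x) := by
  -- Each `y` is charged to a dominating `π y` of at least its weight; `x` receives at most itself
  -- and its neighbours in `T'`.
  choose! π hπI hπ hπg using hdom
  have h1 : ∑ y ∈ T', g y ≤ ∑ x ∈ I, g x * (1 + (nbrs G hV S x ∩ T').card) := by
    calc ∑ y ∈ T', g y ≤ ∑ y ∈ T', g (π y) := Finset.sum_le_sum hπg
      _ = ∑ x ∈ I, ∑ y ∈ T' with π y = x, g (π y) :=
        (Finset.sum_fiberwise_of_maps_to hπI _).symm
      _ ≤ ∑ x ∈ I, g x * (1 + (nbrs G hV S x ∩ T').card) := by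
        refine Finset.sum_le_sum fun x hx => ?_
        have h2 : ∑ y ∈ T' with π y = x, g (π y) = (T'.filter fun y => π y = x).card * g x := by
          rw [← smul_eq_mul, ← Finset.sum_const]
          exact Finset.sum_congr rfl fun y hy => by rw [(Finset.mem_filter.1 hy).2]
        have h3 : (T'.filter fun y => π y = x) ⊆ insert x (nbrs G hV S x ∩ T') := by
          intro y hy
          obtain ⟨hyT, rfl⟩ := Finset.mem_filter.1 hy
          rcases hπ y hyT with h | h
          · exact Finset.mem_insert.2 (.inl h)
          · exact Finset.mem_insert_of_mem (Finset.mem_inter.2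
              ⟨mem_nbrs.2 ⟨Finset.disjoint_left.1 hTS hyT, h⟩, hyT⟩)
        have h4 := (Finset.card_le_card h3).trans (Finset.card_insert_le _ _)
        rw [h2, mul_comm, add_comm 1]
        exact Nat.mul_le_mul_left _ h4
  refine (Nat.add_le_add_right h1 _).trans ?_
  rw [← Finset.sum_add_distrib]
  refine Finset.sum_le_sum fun x hx => ?_
  have h2 := card_nbrs_le hV hE (Finset.disjoint_left.1 hTS (hIT hx))
  have h3 : (nbrs G hV S x ∩ T').card + (nbrs G hV S x ∩ U).card ≤ (nbrs G hV S x).card := by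
    rw [← Finset.card_union_of_disjoint]
    · exact Finset.card_le_card
        (Finset.union_subset Finset.inter_subset_left Finset.inter_subset_left)
    · exact (hTU.mono Finset.inter_subset_right Finset.inter_subset_right)
  -- Since `g x ≥ 1`, each neighbour in `U` may be counted with weight `g x`, and the neighbours in
  -- `T'` and `U` together number at most the degree.
  have h4 := hg x hx
  nlinarith [Nat.mul_le_mul_left (g x) (h3.trans h2),
    Nat.mul_le_mul_right (nbrs G hV S x ∩ U).card (show 1 ≤ g x from h4)]

end Counting

/-! ### The sets to be deleted for given `S` and `T`. -/

section DeletionSets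

variable {α : Type*} {β : Type*} {G : Graph α β}

theorem componentOf_disjoint {G : Graph α β} {K L : Set α} (hK : K ∈ components G)
    (hL : L ∈ components G) {x : α} (hxK : x ∈ K) (hxL : x ∈ L) : K = L := by
  obtain ⟨a, -, rfl⟩ := hK
  obtain ⟨b, -, rfl⟩ := hL
  rw [componentOf_eq hxK, componentOf_eq hxL]

theorem mem_component_of_adj {K : Set α} (hK : K ∈ components G) {x y : α} (hx : x ∈ K)
    (h : G.Adj x y) : y ∈ K := by
  obtain ⟨a, -, rfl⟩ := hK
  exact Relation.ReflTransGen.tail hx h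

set_option maxHeartbeats 1000000 in
/-- For disjoint `S` and `T`, there are an independent set `I₁ ∪ I₀` in `T`, a set `S₁` whose
deletion isolates `I₁`, and a set `S₂` whose deletion makes the vertices of `I₁ ∪ I₀` centers of
different star components, such that `S₂` is small and leaves many components. -/
theorem exists_deletion_sets [G.Loopless] (hV : V(G).Finite) (hE : E(G).Finite) (f : α → ℕ)
    (S T : Finset α) (hSV : (S : Set α) ⊆ V(G)) (hTV : (T : Set α) ⊆ V(G)) (hST : Disjoint S T) :
    ∃ S₁ S₂ I₁ I₀ : Finset α, (S₁ : Set α) ⊆ V(G) ∧ (S₂ : Set α) ⊆ V(G) ∧ Disjoint I₁ I₀ ∧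
      (∀ x ∈ I₁, x ∈ T ∧ degree (G.deleteVerts (S : Set α)) x < f x) ∧ (∀ x ∈ I₀, x ∈ T) ∧
      S₁.card ≤ S.card + ∑ x ∈ I₁, degree (G.deleteVerts (S : Set α)) x ∧
      (∀ x ∈ I₁, x ∈ isolatedVertices (G.deleteVerts (S₁ : Set α))) ∧
      isolatedVertices (G.deleteVerts (S₁ : Set α)) ⊆
        isolatedVertices (G.deleteVerts (S₂ : Set α)) ∧
      (∀ x, x ∈ I₁ ∨ x ∈ I₀ → IsStarCenter (G.deleteVerts (S₂ : Set α)) x) ∧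
      (∀ x, x ∈ I₁ ∨ x ∈ I₀ → ∀ y, y ∈ I₁ ∨ y ∈ I₀ →
        y ∈ componentOf (G.deleteVerts (S₂ : Set α)) x → x = y) ∧
      ∑ x ∈ T, f x + numComponents (G.deleteVerts ((S : Set α) ∪ (T : Set α)))
          + S₂.card + I₁.card + I₀.card ≤
        ∑ x ∈ T, degree (G.deleteVerts (S : Set α)) x + S.card
          + numComponents (G.deleteVerts (S₂ : Set α)) + ∑ x ∈ I₀, f x
          + ∑ x ∈ I₁, (degree (G.deleteVerts (S : Set α)) x
            + (f x - degree (G.deleteVerts (S : Set α)) x)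
              * (1 + degree (G.deleteVerts (S : Set α)) x)) := by
  classical
  set d : α → ℕ := degree (G.deleteVerts (S : Set α)) with hd
  set N : α → Finset α := nbrs G hV S with hN
  have hTS : ∀ x ∈ T, x ∉ S := fun x hx hxS => Finset.disjoint_left.1 hST hxS hx
  set T₁ := T.filter fun x => d x < f x with hT₁
  set T₀ := T.filter fun x => d x = f x with hT₀
  set T₂ := T.filter fun x => f x < d x with hT₂
  obtain ⟨I₁, hI₁T, hI₁ind, hI₁dom⟩ := exists_independent_dominating G.Adj
    (fun _ _ h => h.symm) G.not_adj_self (fun x => f x - d x) T₁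
  set N₁ := I₁.biUnion N with hN₁
  -- With constant weight this is just a maximal independent set.
  obtain ⟨I₀, hI₀T, hI₀ind, hI₀dom⟩ := exists_independent_dominating G.Adj
    (fun _ _ h => h.symm) G.not_adj_self (fun _ => 0) (T₀.filter fun x => x ∉ N₁)
  set N₀ := I₀.biUnion N with hN₀
  have hI₁ : ∀ x ∈ I₁, x ∈ T ∧ d x < f x := fun x hx => Finset.mem_filter.1 (hI₁T hx)
  have hI₀' : ∀ x ∈ I₀, (x ∈ T ∧ d x = f x) ∧ x ∉ N₁ := fun x hx => by
    have h := Finset.mem_filter.1 (hI₀T hx)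
    exact ⟨Finset.mem_filter.1 h.1, h.2⟩
  have hmemN₁ : ∀ y, y ∈ N₁ ↔ ∃ x ∈ I₁, y ∉ S ∧ G.Adj x y := fun y => by
    simp only [hN₁, Finset.mem_biUnion, hN, mem_nbrs]
  have hmemN₀ : ∀ y, y ∈ N₀ ↔ ∃ x ∈ I₀, y ∉ S ∧ G.Adj x y := fun y => by
    simp only [hN₀, Finset.mem_biUnion, hN, mem_nbrs]
  have hN₁V : ∀ y ∈ N₁, y ∈ V(G) := fun y hy => by
    obtain ⟨x, -, -, h⟩ := (hmemN₁ y).1 hy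
    exact h.right_mem
  have hN₀V : ∀ y ∈ N₀, y ∈ V(G) := fun y hy => by
    obtain ⟨x, -, -, h⟩ := (hmemN₀ y).1 hy
    exact h.right_mem
  have hI₁N₁ : ∀ x ∈ I₁, x ∉ N₁ := fun x hx hxN => by
    obtain ⟨y, hy, -, h⟩ := (hmemN₁ x).1 hxN
    exact hI₁ind y hy x hx h
  have hI₀N₀ : ∀ x ∈ I₀, x ∉ N₀ := fun x hx hxN => by
    obtain ⟨y, hy, -, h⟩ := (hmemN₀ x).1 hxN
    exact hI₀ind y hy x hx h
  have hdisI : Disjoint I₁ I₀ := Finset.disjoint_left.2 fun x hx hx' => by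
    have h1 := (hI₁ x hx).2
    have h2 := (hI₀' x hx').1.2
    omega
  -- the components of `G ∖ (S ∪ T)`
  set G' := G.deleteVerts ((S : Set α) ∪ (T : Set α)) with hG'
  have hV'fin : V(G').Finite := hV.subset (by simp [hG'])
  have hG'adj : ∀ x y, G'.Adj x y ↔ G.Adj x y ∧ (x ∉ S ∧ x ∉ T) ∧ (y ∉ S ∧ y ∉ T) := by
    intro x y
    simp [hG', Graph.Adj, not_or]
  set 𝒦 := (finite_components hV'fin).toFinset with h𝒦
  have hmem𝒦 : ∀ K, K ∈ 𝒦 ↔ K ∈ components G' := fun K => by simp [h𝒦]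
  have hKsub : ∀ K ∈ 𝒦, ∀ x ∈ K, x ∈ V(G) ∧ x ∉ S ∧ x ∉ T := by
    intro K hK x hx
    obtain ⟨a, ha, rfl⟩ := (hmem𝒦 K).1 hK
    have := componentOf_subset_vertexSet ha hx
    simpa [hG', not_or] using this
  have hKdis : ∀ K ∈ 𝒦, ∀ L ∈ 𝒦, ∀ x, x ∈ K → x ∈ L → K = L := fun K hK L hL x hxK hxL =>
    componentOf_disjoint ((hmem𝒦 K).1 hK) ((hmem𝒦 L).1 hL) hxK hxL
  -- Components in `𝒜` keep a vertex after `N₁ ∪ N₀` is deleted. The others are dead: those meeting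
  -- `N₁` form `𝒟₁`, those inside `N₀ \ N₁` form `𝒵`, and their loss must be paid for.
  set 𝒜 := 𝒦.filter fun K => ¬ K ⊆ (N₁ : Set α) ∪ (N₀ : Set α) with h𝒜
  set 𝒟 := 𝒦.filter fun K => K ⊆ (N₁ : Set α) ∪ (N₀ : Set α) with h𝒟
  set 𝒟₁ := 𝒟.filter fun K => ∃ x ∈ K, x ∈ N₁ with h𝒟₁
  set 𝒵 := 𝒟.filter fun K => ¬ ∃ x ∈ K, x ∈ N₁ with h𝒵
  have h𝒦card : 𝒜.card + 𝒟₁.card + 𝒵.card = numComponents G' := by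
    have h1 : 𝒟₁.card + 𝒵.card = 𝒟.card := Finset.card_filter_add_card_filter_not _
    have h2 : 𝒟.card + 𝒜.card = 𝒦.card := Finset.card_filter_add_card_filter_not _
    have h3 : 𝒦.card = numComponents G' := (Set.ncard_eq_toFinset_card _ _).symm
    omega
  have h𝒵mem : ∀ K ∈ 𝒵, K ∈ 𝒦 ∧ (∀ x ∈ K, x ∈ N₀) ∧ ∀ x ∈ K, x ∉ N₁ := by
    intro K hK
    obtain ⟨hKD, hno⟩ := Finset.mem_filter.1 hK
    obtain ⟨hKK, hsub⟩ := Finset.mem_filter.1 hKD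
    refine ⟨hKK, fun x hx => ?_, fun x hx hxN => hno ⟨x, hx, hxN⟩⟩
    rcases hsub hx with h | h
    · exact absurd ⟨x, hx, h⟩ hno
    · exact h
  -- a vertex of each dead component away from `I₁`, with a single edge to `I₀` if possible
  have hcex : ∀ K : {K // K ∈ 𝒦}, ∃ c ∈ K.1, (∃ y ∈ K.1, ∃! e, ∃ x ∈ I₀, G.IsLink e x y) →
      ∃! e, ∃ x ∈ I₀, G.IsLink e x c := by
    rintro ⟨K, hK⟩
    by_cases h : ∃ y ∈ K, ∃! e, ∃ x ∈ I₀, G.IsLink e x y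
    · obtain ⟨y, hy, h'⟩ := h
      exact ⟨y, hy, fun _ => h'⟩
    · obtain ⟨a, ha, rfl⟩ := (hmem𝒦 K).1 hK
      exact ⟨a, mem_componentOf_self a, fun h' => absurd h' h⟩
  choose c hcK hcu using hcex
  -- Chosen vertices with a single edge to `I₀` are spared from deletion and become leaves of stars
  -- centered in `I₀`.
  set C := (𝒵.attach.filter fun K =>
      ∃! e, ∃ x ∈ I₀, G.IsLink e x (c ⟨K.1, (h𝒵mem K.1 K.2).1⟩)).image
    fun K => c ⟨K.1, (h𝒵mem K.1 K.2).1⟩ with hC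
  have hCmem : ∀ y, y ∈ C ↔ ∃ K, ∃ hK : K ∈ 𝒵, (∃! e, ∃ x ∈ I₀, G.IsLink e x y) ∧
      c ⟨K, (h𝒵mem K hK).1⟩ = y := by
    intro y
    simp only [hC, Finset.mem_image, Finset.mem_filter, Finset.mem_attach, true_and,
      Subtype.exists]
    constructor
    · rintro ⟨K, hK, h, rfl⟩
      exact ⟨K, hK, h, rfl⟩
    · rintro ⟨K, hK, h, rfl⟩
      exact ⟨K, hK, h, rfl⟩
  have hCprop : ∀ y ∈ C, ∃ K ∈ 𝒵, y ∈ K ∧ (∀ z ∈ C, z ∈ K → z = y) ∧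
      ∃! e, ∃ x ∈ I₀, G.IsLink e x y := by
    intro y hy
    obtain ⟨K, hK, hu, rfl⟩ := (hCmem y).1 hy
    refine ⟨K, hK, hcK ⟨K, (h𝒵mem K hK).1⟩, ?_, hu⟩
    intro z hz hzK
    obtain ⟨L, hL, -, rfl⟩ := (hCmem z).1 hz
    have hKL := hKdis K (h𝒵mem K hK).1 L (h𝒵mem L hL).1 _ hzK (hcK ⟨L, (h𝒵mem L hL).1⟩)
    subst hKL
    rfl
  have hCV : ∀ y ∈ C, (y ∈ V(G) ∧ y ∉ S ∧ y ∉ T) ∧ y ∈ N₀ ∧ y ∉ N₁ := by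
    intro y hy
    obtain ⟨K, hK, hyK, -⟩ := hCprop y hy
    obtain ⟨hKK, h0, h1⟩ := h𝒵mem K hK
    exact ⟨hKsub K hKK y hyK, h0 y hyK, h1 y hyK⟩
  set S₁ := S ∪ N₁ with hS₁
  set J := isolatedVertices (G.deleteVerts (S₁ : Set α)) with hJ
  have hJmem : ∀ x, x ∈ J ↔ (x ∈ V(G) ∧ x ∉ S₁) ∧ ∀ y, G.Adj x y → y ∈ S₁ := by
    intro x
    rw [hJ]
    unfold isolatedVertices
    rw [Set.mem_ofPred_eq, Graph.vertexSet_deleteVerts, Set.mem_sdiff, Finset.mem_coe]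
    refine and_congr_right fun hx => ?_
    rw [Set.eq_empty_iff_forall_notMem]
    constructor
    · rintro h y ⟨e, he⟩
      by_contra hy
      exact h e ⟨y, by simpa using ⟨he, hx.2, hy⟩⟩
    · rintro h e ⟨y, hy⟩
      rw [Graph.deleteVerts_isLink] at hy
      exact hy.2.2 (h y ⟨e, hy.1⟩)
  -- Sparing `J` keeps every vertex isolated by `S₁` isolated, so that iso-toughness at `S₁` and the
  -- star condition at `S₂` can be added over all of `J`.
  set S₂ := (S ∪ N₁ ∪ N₀ ∪ T₂.filter fun x => x ∉ J) \ C with hS₂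
  have hS₂mem : ∀ x, x ∈ S₂ ↔ (x ∈ S ∨ x ∈ N₁ ∨ x ∈ N₀ ∨ (x ∈ T₂ ∧ x ∉ J)) ∧ x ∉ C := by
    intro x
    simp only [hS₂, Finset.mem_sdiff, Finset.mem_union, Finset.mem_filter, or_assoc]
  have hS₁₂ : ∀ x ∈ S₁, x ∈ S₂ := by
    intro x hx
    rw [hS₂mem]
    rcases Finset.mem_union.1 hx with h | h
    · exact ⟨.inl h, fun hC' => (hCV x hC').1.2.1 h⟩
    · exact ⟨.inr (.inl h), fun hC' => (hCV x hC').2.2 h⟩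
  have hTC : ∀ x ∈ T, x ∉ C := fun x hx hxC => (hCV x hxC).1.2.2 hx
  have hI₁J : ∀ x ∈ I₁, x ∈ J := by
    intro x hx
    rw [hJmem]
    refine ⟨⟨hTV (hI₁ x hx).1, ?_⟩, fun y hy => ?_⟩
    · rw [hS₁, Finset.mem_union, not_or]
      exact ⟨hTS x (hI₁ x hx).1, hI₁N₁ x hx⟩
    · rw [hS₁, Finset.mem_union]
      by_cases hyS : y ∈ S
      · exact .inl hyS
      · exact .inr ((hmemN₁ y).2 ⟨x, hx, hyS, hy⟩)
  have hI₀S₁ : ∀ x ∈ I₀, x ∉ S₁ := by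
    intro x hx
    rw [hS₁, Finset.mem_union, not_or]
    exact ⟨hTS x (hI₀' x hx).1.1, (hI₀' x hx).2⟩
  have hJS₂ : ∀ x ∈ J, x ∉ S₂ := by
    intro x hx hxS
    obtain ⟨⟨hxV, hxS₁⟩, hxadj⟩ := (hJmem x).1 hx
    rw [hS₁, Finset.mem_union, not_or] at hxS₁
    rcases ((hS₂mem x).1 hxS).1 with h | h | h | h
    · exact hxS₁.1 h
    · exact hxS₁.2 h
    · obtain ⟨y, hy, -, hyx⟩ := (hmemN₀ x).1 h
      exact hI₀S₁ y hy (hxadj y hyx.symm)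
    · exact h.2 hx
  set G₂ := G.deleteVerts (S₂ : Set α) with hG₂
  have hV₂fin : V(G₂).Finite := hV.subset (by simp [hG₂])
  have hG₂link : ∀ e x y, G₂.IsLink e x y ↔ G.IsLink e x y ∧ x ∉ S₂ ∧ y ∉ S₂ := by
    intro e x y
    simp [hG₂]
  have hG₂adj : ∀ x y, G₂.Adj x y ↔ G.Adj x y ∧ x ∉ S₂ ∧ y ∉ S₂ := by
    intro x y
    simp [Graph.Adj, hG₂link]
  have hG₂V : ∀ x, x ∈ V(G₂) ↔ x ∈ V(G) ∧ x ∉ S₂ := by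
    intro x
    simp [hG₂]
  have hJadj : ∀ x ∈ J, ∀ y, ¬ G₂.Adj x y := by
    intro x hx y hxy
    rw [hG₂adj] at hxy
    exact hxy.2.2 (hS₁₂ y (((hJmem x).1 hx).2 y hxy.1))
  have hJ₂ : J ⊆ isolatedVertices G₂ := by
    intro x hx
    refine ⟨(hG₂V x).2 ⟨((hJmem x).1 hx).1.1, hJS₂ x hx⟩, ?_⟩
    rw [Set.eq_empty_iff_forall_notMem]
    rintro e ⟨y, hy⟩
    exact hJadj x hx y ⟨e, hy⟩
  -- vertices of `T` surviving the deletion of `S₂`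
  have hTsurv : ∀ x ∈ T, x ∉ S₂ → x ∈ J ∨ x ∈ I₀ := by
    intro x hx hxS
    have hxC := hTC x hx
    have hxn : ¬ (x ∈ S ∨ x ∈ N₁ ∨ x ∈ N₀ ∨ (x ∈ T₂ ∧ x ∉ J)) := fun h =>
      hxS ((hS₂mem x).2 ⟨h, hxC⟩)
    push Not at hxn
    obtain ⟨hxS', hxN₁, hxN₀, hxT₂⟩ := hxn
    rcases lt_trichotomy (d x) (f x) with h | h | h
    · obtain ⟨y, hy, hyx, -⟩ := hI₁dom x (Finset.mem_filter.2 ⟨hx, h⟩)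
      rcases hyx with rfl | hyx
      · exact .inl (hI₁J _ hy)
      · exact absurd ((hmemN₁ x).2 ⟨y, hy, hxS', hyx⟩) hxN₁
    · obtain ⟨y, hy, hyx, -⟩ := hI₀dom x
        (Finset.mem_filter.2 ⟨Finset.mem_filter.2 ⟨hx, h⟩, hxN₁⟩)
      rcases hyx with rfl | hyx
      · exact .inr hy
      · exact absurd ((hmemN₀ x).2 ⟨y, hy, hxS', hyx⟩) hxN₀
    · exact .inl (hxT₂ (Finset.mem_filter.2 ⟨hx, h⟩))
  have hIT : ∀ x, x ∈ I₁ ∨ x ∈ I₀ → x ∈ T := by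
    rintro x (hx | hx)
    · exact (hI₁ x hx).1
    · exact (hI₀' x hx).1.1
  have hIS₂ : ∀ x, x ∈ I₁ ∨ x ∈ I₀ → x ∉ S₂ := by
    rintro x (hx | hx)
    · exact hJS₂ x (hI₁J x hx)
    · intro hxS
      have hxS₁ := hI₀S₁ x hx
      rw [hS₁, Finset.mem_union, not_or] at hxS₁
      rcases ((hS₂mem x).1 hxS).1 with h | h | h | h
      · exact hxS₁.1 h
      · exact hxS₁.2 h
      · exact hI₀N₀ x hx h
      · have h1 := (Finset.mem_filter.1 h.1).2
        have h2 := (hI₀' x hx).1.2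
        omega
  have hIadj : ∀ x, x ∈ I₁ ∨ x ∈ I₀ → ∀ y, G₂.Adj x y → y ∈ C ∧ x ∈ I₀ := by
    intro x hx y hxy
    have hxy' := (hG₂adj x y).1 hxy
    have hyS : y ∉ S := fun h => hxy'.2.2 (hS₁₂ y (Finset.mem_union_left _ h))
    rcases hx with hx | hx
    · exact absurd hxy (hJadj x (hI₁J x hx) y)
    · refine ⟨?_, hx⟩
      by_contra hyC
      exact hxy'.2.2 ((hS₂mem y).2 ⟨.inr (.inr (.inl ((hmemN₀ y).2 ⟨x, hx, hyS, hxy'.1⟩))), hyC⟩)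
  -- A surviving neighbour of `y` in `T` lies in `J`, impossible as `J` is isolated, or in `I₀`,
  -- where the edge is unique. Any other lies in the component `K ⊆ N₀` of `y`, of which only `y`
  -- survives.
  have hCadj : ∀ y ∈ C, ∀ x ∈ I₀, G.Adj x y → ∀ z, G₂.Adj y z → z = x := by
    intro y hy x hx hxy z hyz
    obtain ⟨K, hK, hyK, hKC, e, he, heu⟩ := hCprop y hy
    obtain ⟨hKK, hKN₀, hKN₁⟩ := h𝒵mem K hK
    have hyz' := (hG₂adj y z).1 hyz
    have hzS : z ∉ S := fun h => hyz'.2.2 (hS₁₂ z (Finset.mem_union_left _ h))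
    have hy' := (hCV y hy).1
    by_cases hzT : z ∈ T
    · rcases hTsurv z hzT hyz'.2.2 with hzJ | hzI
      · exact absurd hyz.symm (hJadj z hzJ y)
      · obtain ⟨e₁, h₁⟩ := hxy
        obtain ⟨e₂, h₂⟩ := hyz'.1
        have h3 := heu e₁ ⟨x, hx, h₁⟩
        have h4 := heu e₂ ⟨z, hzI, h₂.symm⟩
        rw [h3] at h₁
        rw [h4] at h₂
        exact h₂.right_unique h₁.symm
    · have hzK : z ∈ K := mem_component_of_adj ((hmem𝒦 K).1 hKK) hyK
        ((hG'adj y z).2 ⟨hyz'.1, hy'.2, hzS, hzT⟩)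
      have hzC : z ∈ C := by
        by_contra hzC
        exact hyz'.2.2 ((hS₂mem z).2 ⟨.inr (.inr (.inl (hKN₀ z hzK))), hzC⟩)
      have hzy := hKC z hzC hzK
      exact absurd hzy hyz'.1.ne.symm
  have hcompI : ∀ x, x ∈ I₁ ∨ x ∈ I₀ → componentOf G₂ x ⊆ {y | y = x ∨ (y ∈ C ∧ G₂.Adj x y)} := by
    intro x hx
    refine componentOf_subset (.inl rfl) ?_
    rintro y (rfl | ⟨hyC, hxy⟩) z hyz
    · exact .inr ⟨(hIadj y hx z hyz).1, hyz⟩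
    · exact .inl (hCadj y hyC x (hIadj x hx y hxy).2 ((hG₂adj x y).1 hxy).1 z hyz)
  have hstar : ∀ x, x ∈ I₁ ∨ x ∈ I₀ → IsStarCenter G₂ x := by
    intro x hx
    refine ⟨(hG₂V x).2 ⟨hTV (hIT x hx), hIS₂ x hx⟩, ?_, ?_⟩
    · intro y hy hne
      rcases hcompI x hx hy with h | ⟨hyC, hxy⟩
      · exact absurd h hne
      · have hxI₀ := (hIadj x hx y hxy).2
        obtain ⟨K, -, -, -, e, -, heu⟩ := hCprop y hyC
        obtain ⟨e', he'⟩ := hxy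
        refine ⟨e', he', fun e'' he'' => ?_⟩
        rw [heu e' ⟨x, hxI₀, ((hG₂link _ _ _).1 he').1⟩,
          heu e'' ⟨x, hxI₀, ((hG₂link _ _ _).1 he'').1⟩]
    · intro e y z hy hyz
      rcases hcompI x hx hy with h | ⟨hyC, hxy⟩
      · exact .inl h
      · exact .inr (hCadj y hyC x (hIadj x hx y hxy).2 ((hG₂adj x y).1 hxy).1 z ⟨e, hyz⟩)
  have hsep : ∀ x, x ∈ I₁ ∨ x ∈ I₀ → ∀ y, y ∈ I₁ ∨ y ∈ I₀ → y ∈ componentOf G₂ x → x = y := by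
    intro x hx y hy hxy
    rcases hcompI x hx hxy with h | ⟨hyC, -⟩
    · exact h.symm
    · exact absurd hyC (hTC y (hIT y hy))
  -- counting the components of `G ∖ S₂`
  have hrex : ∀ K : {K // K ∈ 𝒜}, ∃ r ∈ K.1, r ∉ N₁ ∧ r ∉ N₀ := by
    rintro ⟨K, hK⟩
    obtain ⟨r, hr, hr'⟩ := Set.not_subset.1 (Finset.mem_filter.1 hK).2
    simp only [Set.mem_union, Finset.mem_coe, not_or] at hr'
    exact ⟨r, hr, hr'⟩
  choose r hrK hrN using hrex
  have hrinj : Function.Injective r := fun K L hKL => Subtype.ext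
    (hKdis K.1 (Finset.mem_filter.1 K.2).1 L.1 (Finset.mem_filter.1 L.2).1 (r K) (hrK K)
      (hKL ▸ hrK L))
  set R := 𝒜.attach.image r with hR
  have hRcard : R.card = 𝒜.card := by
    rw [hR, Finset.card_image_of_injective _ hrinj, Finset.card_attach]
  have hRmem : ∀ y, y ∈ R ↔ ∃ K, r K = y := by
    intro y
    simp [hR]
  have hRprop : ∀ K, r K ∈ V(G) ∧ r K ∉ S ∧ r K ∉ T := fun K =>
    hKsub K.1 (Finset.mem_filter.1 K.2).1 _ (hrK K)
  have hcompR : ∀ K, componentOf G₂ (r K) ⊆ K.1 := by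
    intro K
    refine componentOf_subset (hrK K) ?_
    intro y hy z hyz
    have hKK := (Finset.mem_filter.1 K.2).1
    have hyz' := (hG₂adj y z).1 hyz
    have hzS : z ∉ S := fun h => hyz'.2.2 (hS₁₂ z (Finset.mem_union_left _ h))
    by_cases hzT : z ∈ T
    · rcases hTsurv z hzT hyz'.2.2 with hzJ | hzI
      · exact absurd hyz.symm (hJadj z hzJ y)
      · obtain ⟨hyC, -⟩ := hIadj z (.inr hzI) y hyz.symm
        obtain ⟨L, hL, hyL, -⟩ := hCprop y hyC
        have hKL := hKdis _ hKK L (h𝒵mem L hL).1 y hy hyL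
        exact absurd ((h𝒵mem L hL).2.1 _ (hKL ▸ hrK K)) (hrN K).2
    · exact mem_component_of_adj ((hmem𝒦 _).1 hKK) hy
        ((hG'adj y z).2 ⟨hyz'.1, (hKsub _ hKK y hy).2, hzS, hzT⟩)
  -- The vertices of `I₁ ∪ I₀` and one surviving vertex from each member of `𝒜` lie in different
  -- components.
  have hcount : I₁.card + I₀.card + 𝒜.card ≤ numComponents G₂ := by
    have hdis : Disjoint (I₁ ∪ I₀) R := by
      rw [Finset.disjoint_left]
      intro x hx hxR
      obtain ⟨K, rfl⟩ := (hRmem x).1 hxR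
      exact (hRprop K).2.2 (hIT _ (Finset.mem_union.1 hx))
    rw [← hRcard, ← Finset.card_union_of_disjoint hdisI, ← Finset.card_union_of_disjoint hdis]
    refine card_le_numComponents hV₂fin _ ?_ ?_
    · intro x hx
      rcases Finset.mem_union.1 hx with hx | hx
      · exact (hstar x (Finset.mem_union.1 hx)).mem
      · obtain ⟨K, rfl⟩ := (hRmem x).1 hx
        refine (hG₂V _).2 ⟨(hRprop K).1, fun h => ?_⟩
        rcases ((hS₂mem _).1 h).1 with h | h | h | h
        · exact (hRprop K).2.1 h
        · exact (hrN K).1 h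
        · exact (hrN K).2 h
        · exact (hRprop K).2.2 (Finset.mem_filter.1 h.1).1
    · intro x hx y hy hxy
      rcases Finset.mem_union.1 hx with hx | hx
      · rw [Finset.mem_union] at hx
        rcases Finset.mem_union.1 hy with hy | hy
        · exact hsep x hx y (Finset.mem_union.1 hy) hxy
        · obtain ⟨K, rfl⟩ := (hRmem y).1 hy
          rcases hcompI x hx hxy with h | ⟨hyC, -⟩
          · exact h.symm
          · exact absurd (hCV _ hyC).2.1 (hrN K).2
      · obtain ⟨K, rfl⟩ := (hRmem x).1 hx
        have hyK := hcompR K hxy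
        have hKK := (Finset.mem_filter.1 K.2).1
        rcases Finset.mem_union.1 hy with hy | hy
        · exact absurd (hIT y (Finset.mem_union.1 hy)) (hKsub _ hKK y hyK).2.2
        · obtain ⟨L, rfl⟩ := (hRmem y).1 hy
          congr 1
          exact Subtype.ext (hKdis _ hKK _ (Finset.mem_filter.1 L.2).1 _ hyK (hrK L))
  have hI₁S : ∀ x ∈ I₁, x ∉ S := fun x hx => hTS x (hI₁ x hx).1
  have hN₁card : N₁.card ≤ ∑ x ∈ I₁, d x :=
    Finset.card_biUnion_le.trans (Finset.sum_le_sum fun x hx => card_nbrs_le hV hE (hI₁S x hx))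
  set U := hV.toFinset \ (S ∪ T) with hU
  have h𝒟₁card : 𝒟₁.card ≤ ∑ x ∈ I₁, (N x ∩ U).card := by
    have hyex : ∀ K : {K // K ∈ 𝒟₁}, ∃ y ∈ K.1, y ∈ N₁ := fun K => (Finset.mem_filter.1 K.2).2
    choose y hyK hyN using hyex
    have hK𝒦 : ∀ K : {K // K ∈ 𝒟₁}, K.1 ∈ 𝒦 := fun K =>
      (Finset.mem_filter.1 (Finset.mem_filter.1 K.2).1).1
    have hyinj : Function.Injective y := fun K L hKL => Subtype.ext
      (hKdis K.1 (hK𝒦 K) L.1 (hK𝒦 L) (y K) (hyK K) (hKL ▸ hyK L))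
    calc 𝒟₁.card = (𝒟₁.attach.image y).card := by
          rw [Finset.card_image_of_injective _ hyinj, Finset.card_attach]
      _ ≤ (I₁.biUnion fun x => N x ∩ U).card := by
          refine Finset.card_le_card fun z hz => ?_
          obtain ⟨K, -, rfl⟩ := Finset.mem_image.1 hz
          obtain ⟨x, hx, hxy⟩ := Finset.mem_biUnion.1 (hyN K)
          have := hKsub _ (hK𝒦 K) _ (hyK K)
          exact Finset.mem_biUnion.2 ⟨x, hx, Finset.mem_inter.2 ⟨hxy, by
            simpa [hU, not_or] using this⟩⟩
      _ ≤ _ := Finset.card_biUnion_le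
  have hweight := sum_add_sum_card_le hV hE (S := S) (T' := T₁) (U := U) (I := I₁)
    (fun x => f x - d x)
    (Finset.disjoint_left.2 fun x hx => hTS x (Finset.mem_filter.1 hx).1)
    (Finset.disjoint_left.2 fun x hx hxU =>
      (Finset.mem_sdiff.1 hxU).2 (Finset.mem_union_right _ (Finset.mem_filter.1 hx).1))
    hI₁T (fun x hx => Nat.sub_pos_of_lt (hI₁ x hx).2) hI₁dom
  -- A representative in `C` supplies an edge not used for `(N₀ \ N₁) \ C`; one outside `C` has a
  -- second edge to `I₀`. Also `d = f` on `I₀`.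
  have h𝒵card : ((N₀ \ N₁) \ C).card + 𝒵.card ≤ ∑ x ∈ I₀, f x := by
    have h1 := card_add_card_le_sum_degree hV hE (S := S) (I := I₀) (A := (N₀ \ N₁) \ C)
      (Finset.disjoint_left.2 fun x hx => hTS x (hI₀' x hx).1.1) hI₀ind
      (fun y hy => Finset.mem_biUnion.1 (Finset.mem_sdiff.1 (Finset.mem_sdiff.1 hy).1).1)
      𝒵.attach (fun K => c ⟨K.1, (h𝒵mem K.1 K.2).1⟩)
      (fun K _ L _ hKL => Subtype.ext (hKdis K.1 (h𝒵mem K.1 K.2).1 L.1 (h𝒵mem L.1 L.2).1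
        (c ⟨K.1, (h𝒵mem K.1 K.2).1⟩) (hcK ⟨K.1, (h𝒵mem K.1 K.2).1⟩)
        (Set.mem_of_eq_of_mem hKL (hcK ⟨L.1, (h𝒵mem L.1 L.2).1⟩))))
      (fun K _ => Finset.mem_biUnion.1 ((h𝒵mem K.1 K.2).2.1 _
        (hcK ⟨K.1, (h𝒵mem K.1 K.2).1⟩)))
      (fun K _ hKA hu => (Finset.mem_sdiff.1 hKA).2 ((hCmem _).2 ⟨K.1, K.2, hu, rfl⟩))
    rw [Finset.card_attach] at h1
    exact h1.trans (Finset.sum_le_sum fun x hx => (hI₀' x hx).1.2.le)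
  have hS₂card : S₂.card ≤ S.card + N₁.card + ((N₀ \ N₁) \ C).card + T₂.card := by
    have hsub : S₂ ⊆ S ∪ N₁ ∪ ((N₀ \ N₁) \ C) ∪ T₂ := by
      intro x hx
      obtain ⟨h, hxC⟩ := (hS₂mem x).1 hx
      by_cases hx₁ : x ∈ N₁
      · exact Finset.mem_union_left _ (Finset.mem_union_left _ (Finset.mem_union_right _ hx₁))
      · rcases h with h | h | h | h
        · exact Finset.mem_union_left _ (Finset.mem_union_left _ (Finset.mem_union_left _ h))
        · exact absurd h hx₁
        · exact Finset.mem_union_left _ (Finset.mem_union_right _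
            (Finset.mem_sdiff.2 ⟨Finset.mem_sdiff.2 ⟨h, hx₁⟩, hxC⟩))
        · exact Finset.mem_union_right _ h.1
    refine (Finset.card_le_card hsub).trans ((Finset.card_union_le _ _).trans ?_)
    gcongr
    refine (Finset.card_union_le _ _).trans ?_
    gcongr
    exact Finset.card_union_le _ _
  -- On `T₂` the surplus `d - f ≥ 1` pays for deleting the vertex.
  have hTsum : ∑ x ∈ T, f x + T₂.card ≤ ∑ x ∈ T, d x + ∑ x ∈ T₁, (f x - d x) := by
    rw [hT₁, hT₂, Finset.sum_filter, Finset.card_filter, ← Finset.sum_add_distrib,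
      ← Finset.sum_add_distrib]
    refine Finset.sum_le_sum fun x _ => ?_
    split_ifs <;> omega
  refine ⟨S₁, S₂, I₁, I₀, ?_, ?_, hdisI, hI₁, fun x hx => (hI₀' x hx).1.1, ?_, hI₁J, hJ₂, hstar,
    hsep, ?_⟩
  · intro x hx
    rcases Finset.mem_union.1 (Finset.mem_coe.1 hx) with h | h
    · exact hSV h
    · exact hN₁V x h
  · intro x hx
    rcases ((hS₂mem x).1 (Finset.mem_coe.1 hx)).1 with h | h | h | h
    · exact hSV h
    · exact hN₁V x h
    · exact hN₀V x h
    · exact hTV (Finset.mem_filter.1 h.1).1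
  · exact (Finset.card_union_le _ _).trans (Nat.add_le_add_left hN₁card _)
  · rw [Finset.sum_add_distrib]
    change ∑ x ∈ T₁, (f x - d x) + ∑ x ∈ I₁, (N x ∩ U).card ≤
      ∑ x ∈ I₁, (f x - d x) * (1 + d x) at hweight
    change _ ≤ numComponents (G.deleteVerts (S₂ : Set α)) at hcount
    omega

end DeletionSets

/-! ### The toughness hypotheses imply the criterion. -/

section IsoToughNearFactor

variable {α : Type*} {β : Type*} {G : Graph α β}

/-- The quadratic part of `tZero`. -/
noncomputable def quadTerm (a : ℝ) (k : ℕ) : ℝ := (((k : ℝ) + a - 1) ^ 2 - parityIndicator a k) / 4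

theorem parityIndicator_le_one (a : ℝ) (k : ℕ) : parityIndicator a k ≤ 1 := by
  unfold parityIndicator
  split_ifs <;> norm_num

theorem parityIndicator_nonneg (a : ℝ) (k : ℕ) : 0 ≤ parityIndicator a k := by
  unfold parityIndicator
  split_ifs <;> norm_num

theorem quadTerm_nonneg {a : ℝ} {k : ℕ} (ha : 1 < a) (hk : a ≤ k) : 0 ≤ quadTerm a k := by
  have := parityIndicator_le_one a k
  unfold quadTerm
  nlinarith

theorem sub_one_mul_tZero {a : ℝ} (ha : 1 < a) (f : α → ℕ) (h : α → ℝ) (x : α) :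
    (a - 1) * tZero a f h x = quadTerm a (f x) - h x := by
  have : a - 1 ≠ 0 := by linarith
  unfold tZero quadTerm
  field_simp
  ring

/-- Completing the square, the difference of the two sides is `((k + a - 1 - 2d)² - ε₀)/4`. If `a`
is an integer with the parity of `k`, the number being squared is an odd integer, so its square is
at least `1 = ε₀`. -/
theorem mul_add_le_quadTerm (a : ℝ) {k d : ℕ} (hd : d ≤ k) :
    a * d + (k - d : ℕ) * (1 + d) ≤ quadTerm a k + k := by
  have key : parityIndicator a k ≤ ((k : ℝ) + a - 1 - 2 * d) ^ 2 := by
    unfold parityIndicator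
    split_ifs with h
    · obtain ⟨m, hm⟩ := h
      have h1 : ((k : ℝ) + a - 1 - 2 * d) = ((2 * (k + m - d) - 1 : ℤ) : ℝ) := by
        push_cast
        linarith
      rw [h1]
      have h2 : (1 : ℤ) ≤ (2 * (k + m - d) - 1) ^ 2 := by
        have : (2 * ((k : ℤ) + m - d) - 1) ≠ 0 := by omega
        have := sq_pos_of_ne_zero this
        omega
      exact_mod_cast h2
    · positivity
  unfold quadTerm
  push_cast [Nat.cast_sub hd]
  nlinarith

theorem finite_isolatedVertices (hV : V(G).Finite) : (isolatedVertices G).Finite :=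
  hV.subset fun _ hx => hx.1

/-- The toughness condition at `S₁` combined with the star condition at `S₂`. -/
theorem sum_add_numComponents_le (hV : V(G).Finite) {f : α → ℕ} {a : ℝ} (ha : 1 < a)
    (hfa : ∀ v ∈ V(G), a ≤ (f v : ℝ)) {h : α → ℝ} (hh : ∀ v ∈ V(G), 0 ≤ h v)
    (hiso : IsIsoTough G (tZero a f h))
    (hstar : ∀ S ⊆ V(G), ∀ I : Set α, IsStarCenterSet (G.deleteVerts S) I →
        (∑ᶠ v ∈ I, ((f v : ℝ) + h v - 1)) + (numComponents (G.deleteVerts S) : ℝ)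
          ≤ (S.ncard : ℝ) + 1)
    {S₁ S₂ I₁ I₀ : Finset α} (hS₁ : (S₁ : Set α) ⊆ V(G)) (hS₂ : (S₂ : Set α) ⊆ V(G))
    (hI : Disjoint I₁ I₀) (hI₁ : ∀ x ∈ I₁, x ∈ isolatedVertices (G.deleteVerts (S₁ : Set α)))
    (hJ : isolatedVertices (G.deleteVerts (S₁ : Set α)) ⊆
      isolatedVertices (G.deleteVerts (S₂ : Set α)))
    (hcen : ∀ x, x ∈ I₁ ∨ x ∈ I₀ → IsStarCenter (G.deleteVerts (S₂ : Set α)) x)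
    (hsep : ∀ x, x ∈ I₁ ∨ x ∈ I₀ → ∀ y, y ∈ I₁ ∨ y ∈ I₀ →
      y ∈ componentOf (G.deleteVerts (S₂ : Set α)) x → x = y) :
    ∑ x ∈ I₁, (quadTerm a (f x) + f x) + ∑ x ∈ I₀, (f x : ℝ)
        + numComponents (G.deleteVerts (S₂ : Set α)) ≤
      (a - 1) * S₁.card + S₂.card + 1 + I₁.card + I₀.card := by
  classical
  set G₁ := G.deleteVerts (S₁ : Set α) with hG₁
  set G₂ := G.deleteVerts (S₂ : Set α) with hG₂
  have hV₁ : V(G₁).Finite := hV.subset (by simp [hG₁])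
  have hV₂ : V(G₂) ⊆ V(G) := by simp [hG₂]
  have hJfin := finite_isolatedVertices hV₁
  set J := hJfin.toFinset with hJdef
  have hJmem : ∀ x, x ∈ J ↔ x ∈ isolatedVertices G₁ := fun x => hJfin.mem_toFinset
  have hPcen : ∀ x ∈ ((J ∪ I₀ : Finset α) : Set α), IsStarCenter G₂ x := by
    intro x hx
    rcases Finset.mem_union.1 (Finset.mem_coe.1 hx) with hx | hx
    · exact isStarCenter_of_isolated (hJ ((hJmem x).1 hx))
    · exact hcen x (.inr hx)
  have hPsep : ∀ x ∈ ((J ∪ I₀ : Finset α) : Set α), ∀ y ∈ ((J ∪ I₀ : Finset α) : Set α),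
      y ∈ componentOf G₂ x → x = y := by
    intro x hx y hy hxy
    rcases Finset.mem_union.1 (Finset.mem_coe.1 hx) with hx | hx
    · rw [componentOf_of_isolated (hJ ((hJmem x).1 hx))] at hxy
      exact (Set.mem_singleton_iff.1 hxy).symm
    · rcases Finset.mem_union.1 (Finset.mem_coe.1 hy) with hy | hy
      · have h1 : x ∈ componentOf G₂ y := componentOf_eq hxy ▸ mem_componentOf_self x
        rw [componentOf_of_isolated (hJ ((hJmem y).1 hy))] at h1
        exact h1
      · exact hsep x (.inr hx) y (.inr hy) hxy
  obtain ⟨I, hIset, hPI⟩ := exists_isStarCenterSet hPcen hPsep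
  have hIV : I ⊆ V(G) := fun x hx => hV₂ (hIset.isStarCenter x hx).mem
  have hIfin : I.Finite := hV.subset hIV
  have h1 := hstar S₂ hS₂ I hIset
  have h2 := hiso S₁ hS₁
  rw [finsum_mem_eq_finite_toFinset_sum _ hIfin, Set.ncard_coe_finset] at h1
  rw [finsum_mem_eq_finite_toFinset_sum _ hJfin, Set.ncard_coe_finset] at h2
  have hnn : ∀ x ∈ V(G), 0 ≤ (f x : ℝ) + h x - 1 := fun x hx => by
    have := hfa x hx
    have := hh x hx
    linarith
  have hPV : ∀ x ∈ J ∪ I₀, x ∈ V(G) := fun x hx => hIV (hPI (Finset.mem_coe.2 hx))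
  have h3 : ∑ x ∈ J ∪ I₀, ((f x : ℝ) + h x - 1) ≤ ∑ x ∈ hIfin.toFinset, ((f x : ℝ) + h x - 1) := by
    refine Finset.sum_le_sum_of_subset_of_nonneg ?_ ?_
    · exact fun x hx => hIfin.mem_toFinset.2 (hPI (Finset.mem_coe.2 hx))
    · exact fun x hx _ => hnn x (hIV (hIfin.mem_toFinset.1 hx))
  -- The contribution of `x` to `a - 1` times iso-toughness plus the star condition; on `J` the two
  -- occurrences of `h x` cancel.
  set φ : α → ℝ := fun x => (if x ∈ J then quadTerm a (f x) - h x else 0) + ((f x : ℝ) + h x - 1)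
    with hφ
  have h4 : ∑ x ∈ J ∪ I₀, φ x
      = (a - 1) * ∑ x ∈ J, tZero a f h x + ∑ x ∈ J ∪ I₀, ((f x : ℝ) + h x - 1) := by
    rw [hφ, Finset.sum_add_distrib, Finset.mul_sum, ← Finset.sum_filter]
    congr 1
    rw [Finset.filter_mem_eq_inter, Finset.union_inter_cancel_left]
    exact Finset.sum_congr rfl fun x _ => (sub_one_mul_tZero ha f h x).symm
  have hφI₁ : ∀ x ∈ J, φ x = quadTerm a (f x) + f x - 1 := by
    intro x hx
    simp only [hφ, if_pos hx]
    ring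
  -- In particular `φ` is nonnegative here, so vertices outside `I₁ ∪ I₀` may be dropped from the
  -- sum.
  have hφI₀ : ∀ x ∈ J ∪ I₀, (f x : ℝ) - 1 ≤ φ x := by
    intro x hx
    have hxV := hPV x hx
    have := quadTerm_nonneg ha (hfa x hxV)
    have := hh x hxV
    by_cases hxJ : x ∈ J
    · rw [hφI₁ x hxJ]
      linarith
    · simp only [hφ, if_neg hxJ]
      linarith
  have hI₁J : I₁ ⊆ J := fun x hx => (hJmem x).2 (hI₁ x hx)
  have h5 : ∑ x ∈ I₁, (quadTerm a (f x) + f x - 1) + ∑ x ∈ I₀, ((f x : ℝ) - 1) ≤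
      ∑ x ∈ J ∪ I₀, φ x := by
    calc _ ≤ ∑ x ∈ I₁, φ x + ∑ x ∈ I₀, φ x := add_le_add
          (Finset.sum_le_sum fun x hx => (hφI₁ x (hI₁J hx)).ge)
          (Finset.sum_le_sum fun x hx => hφI₀ x (Finset.mem_union_right _ hx))
      _ = ∑ x ∈ I₁ ∪ I₀, φ x := (Finset.sum_union hI).symm
      _ ≤ _ := by
        refine Finset.sum_le_sum_of_subset_of_nonneg (Finset.union_subset_union_left hI₁J) ?_
        intro x hx _
        have := hφI₀ x hx
        have := hfa x (hPV x hx)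
        linarith
  have h6 : (a - 1) * ∑ x ∈ J, tZero a f h x ≤ (a - 1) * S₁.card :=
    mul_le_mul_of_nonneg_left h2 (by linarith)
  rw [Finset.sum_sub_distrib, Finset.sum_sub_distrib, Finset.sum_const, Finset.sum_const,
    nsmul_eq_mul, nsmul_eq_mul, mul_one, mul_one] at h5
  linarith

theorem one_le_numComponents (hV : V(G).Finite) {x : α} (hx : x ∈ V(G)) : 1 ≤ numComponents G := by
  have := card_le_numComponents hV {x} (by simpa using hx) (by simp)
  simpa using this

/-- A graph that is tough for `tZero` and satisfies the star condition has a near factor. -/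
theorem hasNearFactor_of_isIsoTough_tZero [G.Loopless] (hV : V(G).Finite) (hE : E(G).Finite)
    {f : α → ℕ} {a : ℝ} (ha : 1 < a) (hfa : ∀ v ∈ V(G), a ≤ (f v : ℝ)) {h : α → ℝ}
    (hh : ∀ v ∈ V(G), 0 ≤ h v) (hiso : IsIsoTough G (tZero a f h))
    (hstar : ∀ S ⊆ V(G), ∀ I : Set α, IsStarCenterSet (G.deleteVerts S) I →
        (∑ᶠ v ∈ I, ((f v : ℝ) + h v - 1)) + (numComponents (G.deleteVerts S) : ℝ)
          ≤ (S.ncard : ℝ) + 1) : HasNearFactor G f := by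
  refine hasNearFactor_of_forall_disjoint hV hE ?_ ?_
  · intro v hv
    by_contra! hlt
    -- Deleting the fewer than `f v` neighbours of `v` isolates it. The combined inequality then
    -- leaves no neighbour at all, and without neighbours it reads `quadTerm a (f v) + f v ≤ 1`, or
    -- less.
    have hd := card_nbrs_le hV hE (S := ∅) (Finset.notMem_empty v)
    rw [Finset.coe_empty, Graph.deleteVerts_empty] at hd
    set S := nbrs G hV ∅ v with hS
    have hvS : v ∉ S := fun h => G.not_adj_self v (mem_nbrs.1 h).2
    have hSV : (S : Set α) ⊆ V(G) := fun y hy => (mem_nbrs.1 hy).2.right_mem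
    have hvV : v ∈ V(G.deleteVerts (S : Set α)) := by
      rw [Graph.vertexSet_deleteVerts]
      exact ⟨hv, hvS⟩
    have hviso : v ∈ isolatedVertices (G.deleteVerts (S : Set α)) := by
      refine ⟨hvV, ?_⟩
      rw [Set.eq_empty_iff_forall_notMem]
      rintro e ⟨y, hy⟩
      rw [Graph.deleteVerts_isLink] at hy
      exact hy.2.2 (mem_nbrs.2 ⟨Finset.notMem_empty y, e, hy.1⟩)
    have key := sum_add_numComponents_le hV ha hfa hh hiso hstar (S₁ := S) (S₂ := S)
      (I₁ := {v}) (I₀ := ∅) hSV hSV (by simp) (by simpa using hviso) le_rfl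
      (by simpa using isStarCenter_of_isolated hviso) (by simp)
    simp only [Finset.sum_singleton, Finset.sum_empty, Finset.card_singleton, Finset.card_empty,
      Nat.cast_one, Nat.cast_zero, add_zero] at key
    have h1 := one_le_numComponents (hV.subset Graph.deleteVerts_le.vertexSet_mono) hvV
    have h1' : (1 : ℝ) ≤ numComponents (G.deleteVerts (S : Set α)) := by exact_mod_cast h1
    have h2 := mul_add_le_quadTerm a (hd.trans hlt.le)
    have h3 : S.card + 1 ≤ f v := by omega
    have h4 : (1 : ℝ) ≤ (f v - S.card : ℕ) := by
      exact_mod_cast Nat.le_sub_of_add_le (by omega)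
    have h5 := quadTerm_nonneg ha (hfa v hv)
    have h6 := hfa v hv
    have h7 : (0 : ℝ) ≤ S.card := Nat.cast_nonneg _
    have h8 : (1 : ℝ) + S.card ≤ (f v - S.card : ℕ) * (1 + S.card) := by nlinarith
    have h9 : (S.card : ℝ) ≤ 0 := by linarith
    have h10 : (S.card : ℝ) = 0 := le_antisymm h9 h7
    rw [h10] at key
    linarith
  · intro S T hSV hTV hST
    obtain ⟨S₁, S₂, I₁, I₀, hS₁V, hS₂V, hdis, hI₁, -, hS₁, hI₁iso, hJ, hcen, hsep, hcount⟩ :=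
      exists_deletion_sets hV hE f S T hSV hTV hST
    have key := sum_add_numComponents_le hV ha hfa hh hiso hstar hS₁V hS₂V hdis hI₁iso hJ hcen hsep
    set d : α → ℕ := degree (G.deleteVerts (S : Set α)) with hd
    have hS₁' : (a - 1) * (S₁.card : ℝ) ≤ (a - 1) * (S.card + ∑ x ∈ I₁, (d x : ℝ)) := by
      refine mul_le_mul_of_nonneg_left ?_ (by linarith)
      exact_mod_cast hS₁
    have hquad : ∑ x ∈ I₁, (a * d x + ((f x - d x : ℕ) : ℝ) * (1 + d x)) ≤
        ∑ x ∈ I₁, (quadTerm a (f x) + f x) :=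
      Finset.sum_le_sum fun x hx => mul_add_le_quadTerm a (hI₁ x hx).2.le
    have hSf : a * S.card ≤ ∑ x ∈ S, (f x : ℝ) := by
      rw [mul_comm, ← nsmul_eq_mul, ← Finset.sum_const]
      exact Finset.sum_le_sum fun x hx => hfa x (hSV hx)
    have hcount' : ∑ x ∈ T, (f x : ℝ)
          + numComponents (G.deleteVerts ((S : Set α) ∪ (T : Set α)))
          + S₂.card + I₁.card + I₀.card ≤
        ∑ x ∈ T, (d x : ℝ) + S.card
          + numComponents (G.deleteVerts (S₂ : Set α)) + ∑ x ∈ I₀, (f x : ℝ)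
          + ∑ x ∈ I₁, ((d x : ℝ) + ((f x - d x : ℕ) : ℝ) * (1 + d x)) := by
      exact_mod_cast hcount
    rw [Finset.sum_add_distrib, ← Finset.mul_sum] at hquad
    rw [Finset.sum_add_distrib (s := I₁)] at hcount'
    -- Since `|S₁| ≤ |S| + d(I₁)`, the multiplier `a - 1` plus one gives the coefficient `a` both to
    -- `|S|`, absorbed by `f(S)`, and to `d` on `I₁`, absorbed by the quadratic bound.
    have hfinal : ∑ x ∈ T, (f x : ℝ)
          + numComponents (G.deleteVerts ((S : Set α) ∪ (T : Set α))) ≤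
        ∑ x ∈ S, (f x : ℝ) + ∑ x ∈ T, (d x : ℝ) + 1 := by
      linarith
    exact_mod_cast hfinal

/-- Splitting the nontrivial star components: deleting the leaves isolates all chosen centers, and
deleting the nontrivial centers isolates all leaves. -/
theorem IsStarCenterSet.exists_leaves {H : Graph α β} [H.Loopless] (hV : V(H).Finite) {I : Set α}
    (hI : IsStarCenterSet H I) : ∃ L C : Finset α, (L : Set α) ⊆ V(H) ∧ (C : Set α) ⊆ I ∧
      C.card ≤ L.card ∧ I ⊆ isolatedVertices (H.deleteVerts (L : Set α)) ∧
      numComponents H + L.card ≤ numComponents (H.deleteVerts (C : Set α)) + C.card := by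
  classical
  have hIV : I ⊆ V(H) := fun x hx => (hI.isStarCenter x hx).mem
  have hIuniq : ∀ x ∈ I, ∀ y ∈ I, y ∈ componentOf H x → x = y := fun x hx y hy hxy =>
    (hI.existsUnique x (hI.isStarCenter x hx)).unique ⟨hx, mem_componentOf_self x⟩ ⟨hy, hxy⟩
  have hsymm : ∀ {x y : α}, y ∈ componentOf H x → x ∈ componentOf H y := fun {x y} hxy =>
    componentOf_eq hxy ▸ mem_componentOf_self x
  -- Leaves are taken relative to `I`; in `K_{1,1}` the end not chosen in `I` is the leaf.
  set L := hV.toFinset.filter fun y => ∃ x ∈ I, y ∈ componentOf H x ∧ y ≠ x with hL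
  have hLmem : ∀ y, y ∈ L ↔ ∃ x ∈ I, y ∈ componentOf H x ∧ y ≠ x := by
    intro y
    rw [hL, Finset.mem_filter, Set.Finite.mem_toFinset]
    refine and_iff_right_of_imp ?_
    rintro ⟨x, hx, hxy, -⟩
    exact componentOf_subset_vertexSet (hIV hx) hxy
  set C := hV.toFinset.filter fun x => x ∈ I ∧ ∃ y ∈ componentOf H x, y ≠ x with hC
  have hCmem : ∀ x, x ∈ C ↔ x ∈ I ∧ ∃ y ∈ componentOf H x, y ≠ x := by
    intro x
    rw [hC, Finset.mem_filter, Set.Finite.mem_toFinset]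
    exact and_iff_right_of_imp fun h => hIV h.1
  have hLI : ∀ y ∈ L, y ∉ I := by
    intro y hy hyI
    obtain ⟨x, hx, hxy, hne⟩ := (hLmem y).1 hy
    exact hne (hIuniq x hx y hyI hxy).symm
  refine ⟨L, C, ?_, ?_, ?_, ?_, ?_⟩
  · exact fun y hy => by
      have := (Finset.mem_filter.1 (Finset.mem_coe.1 hy)).1
      simpa using this
  · exact fun x hx => ((hCmem x).1 (Finset.mem_coe.1 hx)).1
  · have hex : ∀ x : {x // x ∈ C}, ∃ y ∈ componentOf H x.1, y ≠ x.1 :=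
      fun x => ((hCmem x.1).1 x.2).2
    choose y hy hne using hex
    have hinj : Function.Injective y := by
      intro x x' hxx
      have h1 : x'.1 ∈ componentOf H x.1 := by
        rw [componentOf_eq (hy x), hxx]
        exact hsymm (hy x')
      exact Subtype.ext (hIuniq _ ((hCmem _).1 x.2).1 _ ((hCmem _).1 x'.2).1 h1)
    rw [← Finset.card_attach, ← Finset.card_image_of_injective _ hinj]
    refine Finset.card_le_card fun z hz => ?_
    obtain ⟨x, -, rfl⟩ := Finset.mem_image.1 hz
    exact (hLmem _).2 ⟨x, ((hCmem _).1 x.2).1, hy x, hne x⟩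
  · intro x hx
    have hxL : x ∉ L := fun h => hLI x h hx
    refine ⟨by simpa using ⟨hIV hx, hxL⟩, ?_⟩
    rw [Set.eq_empty_iff_forall_notMem]
    rintro e ⟨y, hy⟩
    rw [Graph.deleteVerts_isLink] at hy
    have hxy : y ∈ componentOf H x := Relation.ReflTransGen.single ⟨e, hy.1⟩
    exact hy.2.2 ((hLmem y).2 ⟨x, hx, hxy, hy.1.ne.symm⟩)
  · set H' := H.deleteVerts (C : Set α) with hH'
    have hV'fin : V(H').Finite := hV.subset (by simp [hH'])
    have hH'adj : ∀ x y, H'.Adj x y ↔ H.Adj x y ∧ x ∉ C ∧ y ∉ C := by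
      intro x y
      simp [hH', Graph.Adj]
    set 𝒦 := (finite_components hV).toFinset.filter fun K => ∀ x ∈ C, componentOf H x ≠ K with h𝒦
    have h𝒦mem : ∀ K ∈ 𝒦, K ∈ components H ∧ ∀ x ∈ C, x ∉ K := by
      intro K hK
      obtain ⟨hK1, hK2⟩ := Finset.mem_filter.1 hK
      have hK3 := (Set.Finite.mem_toFinset _).1 hK1
      refine ⟨hK3, fun x hx hxK => hK2 x hx ?_⟩
      obtain ⟨b, -, rfl⟩ := hK3
      exact (componentOf_eq hxK).symm
    have hcard : numComponents H ≤ 𝒦.card + C.card := by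
      have h1 : numComponents H = (finite_components hV).toFinset.card :=
        Set.ncard_eq_toFinset_card _ _
      rw [h1, ← Finset.card_filter_add_card_filter_not fun K => ∀ x ∈ C, componentOf H x ≠ K]
      refine Nat.add_le_add_left ((Finset.card_le_card ?_).trans
        (Finset.card_image_le (s := C) (f := componentOf H))) _
      intro K hK
      have h2 := (Finset.mem_filter.1 hK).2
      push Not at h2
      obtain ⟨x, hx, rfl⟩ := h2
      exact Finset.mem_image_of_mem _ hx
    have hrex : ∀ K : {K // K ∈ 𝒦}, ∃ r ∈ K.1, r ∈ V(H) := by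
      rintro ⟨K, hK⟩
      obtain ⟨b, hb, rfl⟩ := (h𝒦mem K hK).1
      exact ⟨b, mem_componentOf_self b, hb⟩
    choose r hrK hrV using hrex
    have hrinj : Function.Injective r := fun K K' hKK => Subtype.ext
      (componentOf_disjoint (h𝒦mem _ K.2).1 (h𝒦mem _ K'.2).1 (hrK K) (hKK ▸ hrK K'))
    have hRcard : (𝒦.attach.image r).card = 𝒦.card := by
      rw [Finset.card_image_of_injective _ hrinj, Finset.card_attach]
    have hLK : ∀ y ∈ L, ∀ K ∈ 𝒦, y ∉ K := by
      intro y hy K hK hyK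
      obtain ⟨x, hx, hxy, hne⟩ := (hLmem y).1 hy
      refine (h𝒦mem K hK).2 x ((hCmem x).2 ⟨hx, y, hxy, hne⟩) ?_
      obtain ⟨b, -, rfl⟩ := (h𝒦mem K hK).1
      rw [componentOf_eq hyK]
      exact hsymm hxy
    have hcompL : ∀ y ∈ L, componentOf H' y ⊆ {y} := by
      intro y hy
      obtain ⟨x, hx, hxy, hne⟩ := (hLmem y).1 hy
      refine componentOf_subset rfl ?_
      rintro _ rfl z hz
      obtain ⟨⟨e, he⟩, hyC, hzC⟩ := (hH'adj _ z).1 hz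
      rcases (hI.isStarCenter x hx).eq_or_eq e _ z hxy he with h | h
      · exact absurd h hne
      · exact absurd ((hCmem x).2 ⟨hx, _, hxy, hne⟩) (h ▸ hzC)
    have hcompR : ∀ K, componentOf H' (r K) ⊆ K.1 := by
      intro K
      refine componentOf_subset (hrK K) fun y hy z hz => ?_
      exact mem_component_of_adj (h𝒦mem _ K.2).1 hy ((hH'adj y z).1 hz).1
    have hdis : Disjoint L (𝒦.attach.image r) := by
      rw [Finset.disjoint_left]
      intro y hy hyR
      obtain ⟨K, -, rfl⟩ := Finset.mem_image.1 hyR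
      exact hLK _ hy _ K.2 (hrK K)
    have hge := card_le_numComponents hV'fin (L ∪ 𝒦.attach.image r) ?_ ?_
    · rw [Finset.card_union_of_disjoint hdis, hRcard] at hge
      omega
    · intro y hy
      rw [hH', Graph.vertexSet_deleteVerts]
      rcases Finset.mem_union.1 hy with hy | hy
      · obtain ⟨x, hx, hxy, hne⟩ := (hLmem y).1 hy
        exact ⟨componentOf_subset_vertexSet (hIV hx) hxy, fun h => hLI y hy ((hCmem y).1 h).1⟩
      · obtain ⟨K, -, rfl⟩ := Finset.mem_image.1 hy
        exact ⟨hrV K, fun h => (h𝒦mem _ K.2).2 _ h (hrK K)⟩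
    · intro y hy z hz hyz
      rcases Finset.mem_union.1 hy with hy | hy
      · exact (Set.mem_singleton_iff.1 (hcompL y hy hyz)).symm
      · obtain ⟨K, -, rfl⟩ := Finset.mem_image.1 hy
        have hzK := hcompR K hyz
        rcases Finset.mem_union.1 hz with hz | hz
        · exact absurd hzK (hLK z hz _ K.2)
        · obtain ⟨K', -, rfl⟩ := Finset.mem_image.1 hz
          congr 1
          exact Subtype.ext (componentOf_disjoint (h𝒦mem _ K.2).1 (h𝒦mem _ K'.2).1 hzK (hrK K'))

theorem deleteVerts_deleteVerts (S T : Set α) :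
    (G.deleteVerts S).deleteVerts T = G.deleteVerts (S ∪ T) := by
  refine Graph.ext ?_ ?_
  · simp [Set.sdiff_sdiff]
  · intro e x y
    simp only [Graph.deleteVerts_isLink, Set.mem_union]
    tauto

/-- Iso-toughness together with a bound on the number of components forces a near factor. -/
theorem hasNearFactor_of_isIsoTough_max [G.Loopless] (hV : V(G).Finite) (hE : E(G).Finite)
    {f : α → ℕ} {a : ℝ} (ha : 1 < a) (hfa : ∀ v ∈ V(G), a ≤ (f v : ℝ)) {n : ℝ} (hn : 1 < n)
    (hiso : IsIsoTough G (fun v => max (n / (n - 1) * (f v : ℝ))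
      (1 / (4 * (a - 1 / n)) * (((f v : ℝ) + a - 1) ^ 2 + 4 * (f v : ℝ)))))
    (hcomp : ∀ S ⊆ V(G), (numComponents (G.deleteVerts S) : ℝ) ≤ 1 / n * (S.ncard : ℝ) + 1) :
    HasNearFactor G f := by
  set t : α → ℝ := fun v => max (n / (n - 1) * (f v : ℝ))
    (1 / (4 * (a - 1 / n)) * (((f v : ℝ) + a - 1) ^ 2 + 4 * (f v : ℝ))) with ht
  have hn0 : 0 < n := by linarith
  have hn1 : 0 < n - 1 := by linarith
  have hninv : 1 / n < 1 := by rw [div_lt_one hn0]; exact hn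
  have hninv0 : 0 < 1 / n := by positivity
  -- The first term of the maximum makes `h = (1 - 1/n) t - f` nonnegative; the second yields `t₀ ≤
  -- t`, because `(a - 1/n) - (1 - 1/n) = a - 1`.
  have htf : ∀ v, (f v : ℝ) ≤ (1 - 1 / n) * t v := by
    intro v
    have h1 : n / (n - 1) * (f v : ℝ) ≤ t v := le_max_left _ _
    have h2 : (1 - 1 / n) * (n / (n - 1) * (f v : ℝ)) = f v := by
      field_simp
    rw [← h2]
    exact mul_le_mul_of_nonneg_left h1 (by linarith)
  have ht0 : ∀ v, 0 ≤ t v := fun v => le_max_of_le_left (by positivity)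
  have htq : ∀ v, (((f v : ℝ) + a - 1) ^ 2 + 4 * (f v : ℝ)) / 4 ≤ (a - 1 / n) * t v := by
    intro v
    have h1 : 1 / (4 * (a - 1 / n)) * (((f v : ℝ) + a - 1) ^ 2 + 4 * (f v : ℝ)) ≤ t v :=
      le_max_right _ _
    have h3 : 0 < a - 1 / n := by linarith
    have h4 := mul_le_mul_of_nonneg_left h1 h3.le
    refine le_trans (le_of_eq ?_) h4
    have h5 : a - 1 / n ≠ 0 := h3.ne'
    generalize a - 1 / n = b at h5
    field_simp
  have hle : ∀ v, tZero a f (fun v => (1 - 1 / n) * t v - f v) v ≤ t v := by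
    intro v
    have h1 := sub_one_mul_tZero ha f (fun v => (1 - 1 / n) * t v - f v) v
    have h2 := htq v
    have h3 := parityIndicator_nonneg a (f v)
    refine le_of_mul_le_mul_left ?_ (show 0 < a - 1 by linarith)
    rw [h1]
    unfold quadTerm
    linarith
  refine hasNearFactor_of_isIsoTough_tZero hV hE ha hfa
    (h := fun v => (1 - 1 / n) * t v - f v) (fun v _ => by linarith [htf v]) ?_ ?_
  · intro S hS
    refine le_trans ?_ (hiso S hS)
    have hfin := finite_isolatedVertices (hV.subset (Graph.deleteVerts_le (X := S)).vertexSet_mono)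
    rw [finsum_mem_eq_finite_toFinset_sum _ hfin, finsum_mem_eq_finite_toFinset_sum _ hfin]
    exact Finset.sum_le_sum fun v _ => hle v
  · intro S hS I hI
    have hH : V(G.deleteVerts S) ⊆ V(G) := (Graph.deleteVerts_le (X := S)).vertexSet_mono
    have hHfin : V(G.deleteVerts S).Finite := hV.subset hH
    have : (G.deleteVerts S).Loopless := Graph.Loopless.anti Graph.deleteVerts_le
    -- As `f + h - 1 = (1 - 1/n) t - 1`, iso-toughness at `S ∪ L` is used with weight `1 - 1/n` and
    -- the component bound at `S ∪ C` with weight one. The remainder `(|C| - |L|)/n + |C| - |I|` is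
    -- nonpositive.
    obtain ⟨L, C, hL, hC, hCL, hIL, hcount⟩ := hI.exists_leaves hHfin
    have hIV : I ⊆ V(G.deleteVerts S) := fun x hx => (hI.isStarCenter x hx).mem
    have hIfin : I.Finite := hHfin.subset hIV
    rw [deleteVerts_deleteVerts] at hIL hcount
    have h1 := hiso (S ∪ L) (Set.union_subset hS (hL.trans hH))
    have h2 := hcomp (S ∪ C) (Set.union_subset hS ((hC.trans hIV).trans hH))
    have hfin := finite_isolatedVertices
      (hV.subset (Graph.deleteVerts_le (G := G) (X := S ∪ L)).vertexSet_mono)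
    rw [finsum_mem_eq_finite_toFinset_sum _ hfin] at h1
    rw [finsum_mem_eq_finite_toFinset_sum _ hIfin]
    have h3 : ∑ x ∈ hIfin.toFinset, t x ≤ ∑ x ∈ hfin.toFinset, t x :=
      Finset.sum_le_sum_of_subset_of_nonneg
        (fun x hx => hfin.mem_toFinset.2 (hIL (hIfin.mem_toFinset.1 hx))) fun x _ _ => ht0 x
    have h4 : (((S ∪ (L : Set α)).ncard : ℕ) : ℝ) ≤ S.ncard + L.card := by
      have := Set.ncard_union_le S (L : Set α)
      rw [Set.ncard_coe_finset] at this
      exact_mod_cast this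
    have h5 : (((S ∪ (C : Set α)).ncard : ℕ) : ℝ) ≤ S.ncard + C.card := by
      have := Set.ncard_union_le S (C : Set α)
      rw [Set.ncard_coe_finset] at this
      exact_mod_cast this
    have h6 : (C.card : ℝ) ≤ hIfin.toFinset.card := by
      exact_mod_cast Finset.card_le_card fun x hx => hIfin.mem_toFinset.2 (hC (Finset.mem_coe.2 hx))
    have h7 : (C.card : ℝ) ≤ L.card := by exact_mod_cast hCL
    have h8 : (numComponents (G.deleteVerts S) : ℝ) + L.card ≤
        numComponents (G.deleteVerts (S ∪ (C : Set α))) + C.card := by exact_mod_cast hcount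
    have h9 : ∑ x ∈ hIfin.toFinset, ((f x : ℝ) + ((1 - 1 / n) * t x - f x) - 1)
        = (1 - 1 / n) * ∑ x ∈ hIfin.toFinset, t x - hIfin.toFinset.card := by
      rw [Finset.mul_sum, ← mul_one ((hIfin.toFinset.card : ℕ) : ℝ), ← nsmul_eq_mul,
        ← Finset.sum_const, ← Finset.sum_sub_distrib]
      exact Finset.sum_congr rfl fun x _ => by ring
    have h10 : (1 - 1 / n) * ∑ x ∈ hIfin.toFinset, t x ≤ (1 - 1 / n) * (S.ncard + L.card) :=
      mul_le_mul_of_nonneg_left (h3.trans (h1.trans h4)) (by linarith)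
    have h11 : 1 / n * (((S ∪ (C : Set α)).ncard : ℕ) : ℝ) ≤ 1 / n * (S.ncard + C.card) :=
      mul_le_mul_of_nonneg_left h5 hninv0.le
    have h12 : 1 / n * (C.card : ℝ) ≤ 1 / n * L.card := mul_le_mul_of_nonneg_left h7 hninv0.le
    change _ + ((numComponents (G.deleteVerts S) : ℕ) : ℝ) ≤ _
    rw [h9]
    linarith

end IsoToughNearFactor

end IsoTough

theorem mainTheorem9 {α β : Type*} (G : Graph α β) [G.Loopless]
    (hV : V(G).Finite) (hE : E(G).Finite)
    (f : α → ℕ) (a : ℝ) (ha : 1 < a) (hfa : ∀ v ∈ V(G), a ≤ (f v : ℝ)) :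
    (∀ h : α → ℝ, (∀ v ∈ V(G), 0 ≤ h v) →
      IsoTough.IsIsoTough G (IsoTough.tZero a f h) →
      (∀ S ⊆ V(G), ∀ I : Set α, IsoTough.IsStarCenterSet (G.deleteVerts S) I →
        (∑ᶠ v ∈ I, ((f v : ℝ) + h v - 1)) + (IsoTough.numComponents (G.deleteVerts S) : ℝ)
          ≤ (S.ncard : ℝ) + 1) →
      IsoTough.HasNearFactor G f) ∧
    (∀ n : ℝ, 1 < n →
      IsoTough.IsIsoTough G (fun v =>
        max (n / (n - 1) * (f v : ℝ))
          (1 / (4 * (a - 1 / n)) * (((f v : ℝ) + a - 1) ^ 2 + 4 * (f v : ℝ)))) →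
      (∀ S ⊆ V(G), (IsoTough.numComponents (G.deleteVerts S) : ℝ)
        ≤ 1 / n * (S.ncard : ℝ) + 1) →
      IsoTough.HasNearFactor G f) :=
  ⟨fun _ hh hiso hstar => IsoTough.hasNearFactor_of_isIsoTough_tZero hV hE ha hfa hh hiso hstar,
    fun _ hn hiso hcomp => IsoTough.hasNearFactor_of_isIsoTough_max hV hE ha hfa hn hiso hcomp⟩
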